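/- Let $\alpha_1,\dots,\alpha_n\in\mathbb C$ be distinct and $p(z)=\prod_i(z-\alpha_i)$. The Jacobi Ehrlich--Aberth method for $p$ replaces simultaneously every coordinate $z_i$ of $(z_1,\dots,z_n)\in\mathbb C^n$ by $z_i-q_i(z_i)/q_i'(z_i)$, where $q_i(t)=p(t)/\prod_{j\ne i}(t-z_j)$. This extends to a rational map $\mathrm{JEA}_p\colon(\mathbb P^1)^n\dashrightarrow(\mathbb P^1)^n$, where $\mathbb P^1=\mathbb C\cup\{\infty\}$. Let $$\mathrm{CR}(a,b,c,d)=\frac{(a-c)(b-d)}{(a-d)(b-c)}.$$ **Proposition.** There is a nonempty open set $U\subset\mathbb C$ such that the following holds for all pairwise distinct $\alpha_1,\alpha_2,\alpha_3,\alpha_4\in\mathbb C$ that are, in this cyclic order, the vertices of a (possibly degenerate) parallelogram, i.e. $\alpha_1+\alpha_3=\alpha_2+\alpha_4$. Let $p(z)=\prod_{i=1}^4(z-\alpha_i)$. Then $\mathrm{JEA}_p$ has a two-cycle $\{\zeta,\zeta'\}$ ($\zeta\neq\zeta'$, $\mathrm{JEA}_p$ defined at both points and interchanging them) contained in $(\mathbb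 P^1)^4\setminus\mathbb C^4$. If moreover $\mathrm{CR}(\alpha_1,\alpha_2,\alpha_3,\alpha_4)\in U$, then, for this cycle: 1. The cycle is hyperbolic with one attracting direction: the derivative at $\zeta$ of the second iterate $\mathrm{JEA}_p\circ\mathrm{JEA}_p$ is invertible, has no eigenvalue of modulus $1$, and has exactly one eigenvalue, counted with multiplicity, of modulus less than $1$. 2. The point $\zeta$ has a local stable manifold of complex dimension one. That is, there are an open neighbourhood $N$ of $\zeta$ in $(\mathbb P^1)^4$ and a holomorphically embedded open disc $W\ni\zeta$, tangent at $\zeta$ to the attracting eigendirection, such that $W$ is exactly the set of points whose forward $\mathrm{JEA}_p$-orbit is defined for all times, lies in $N$ at all even times, and converges to $\zeta$ along the even times. 3. $W\setminus\{\zeta\}\subset\mathbb C^4$, and every point of $W\setminus\{\zeta\}$ is the starting point of a diverging orbit in $\mathbb C^4$: all its iterates $z^{(k)}$ under the Jacobi Ehrlich--Aberth method are defined and lie in $\mathbb C^4$, and $\|z^{(k)}\|\to\infty$ as $k\to\infty$. -/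

import Mathlib

open Polynomial Topology Filter
open scoped OnePoint

noncomputable section

namespace EA

/-- The Riemann sphere `ℙ¹(ℂ)`, with the topology of the one-point compactification. -/
abbrev P1 : Type := OnePoint ℂ

/-- Homogeneous coordinates: `z ↦ [z : 1]` and `∞ ↦ [1 : 0]`. -/
def hom (z : P1) : ℂ × ℂ := z.elim (1, 0) (fun t => (t, 1))

/-- The point of `ℙ¹` with homogeneous coordinates `[v.1 : v.2]` (for `v ≠ 0`). -/
def ofHom (v : ℂ × ℂ) : P1 := if v.2 = 0 then ∞ else ((v.1 / v.2 : ℂ) : P1)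

/-- The bracket `x v - y u` of `z = [x : y]` and `w = [u : v]`; it is `z - w` for finite points. -/
def br (z w : P1) : ℂ := (hom z).1 * (hom w).2 - (hom z).2 * (hom w).1

/-- The inclusion `ℂⁿ ⊆ (ℙ¹)ⁿ`. -/
def incl {n : ℕ} (z : Fin n → ℂ) : Fin n → P1 := fun i => (z i : P1)

/-- The subset `ℂⁿ` of `(ℙ¹)ⁿ`. -/
def finitePart (n : ℕ) : Set (Fin n → P1) := Set.range incl

/-! ### The Ehrlich–Aberth method on `ℂⁿ` -/

/-- The monic polynomial `∏ (X - αᵢ)`. -/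
def rootPoly {n : ℕ} (α : Fin n → ℂ) : ℂ[X] := ∏ i, (X - C (α i))

/-- The rational function `qᵢ(t) = p(t) / ∏_{j ≠ i} (t - zⱼ)`. -/
def q {n : ℕ} (p : ℂ[X]) (z : Fin n → ℂ) (i : Fin n) (t : ℂ) : ℂ :=
  p.eval t / ∏ j ∈ Finset.univ.erase i, (t - z j)

/-- `z'` is the result of one Jacobi Ehrlich–Aberth step in `ℂⁿ` from `z`: every coordinate is
simultaneously replaced by `zᵢ - qᵢ(zᵢ) / qᵢ'(zᵢ)`, no denominator being zero. -/
def IsAffineStep {n : ℕ} (p : ℂ[X]) (z z' : Fin n → ℂ) : Prop :=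
  ∀ i, (∀ j, j ≠ i → z i ≠ z j) ∧ deriv (q p z i) (z i) ≠ 0 ∧
    z' i = z i - q p z i (z i) / deriv (q p z i) (z i)

/-- An orbit in `ℂⁿ` of the Jacobi Ehrlich–Aberth method. -/
def IsAffineOrbit {n : ℕ} (p : ℂ[X]) (z : ℕ → Fin n → ℂ) : Prop :=
  ∀ k, IsAffineStep p (z k) (z (k + 1))

/-! ### The extension to a rational map of `(ℙ¹)ⁿ` -/

/-- The `i`-th component of the extension, in homogeneous coordinates. With `zᵢ = [x : y]`,
`zⱼ = [uⱼ : vⱼ]`, `A_k = x - y α_k` and `B_j = x vⱼ - y uⱼ` it is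
`[∑ α_k / A_k - ∑_{j ≠ i} uⱼ / B_j : ∑ 1 / A_k - ∑_{j ≠ i} vⱼ / B_j]`, multiplied by
`∏ A_k ∏ B_j`. These are two multihomogeneous polynomials in the coordinates of the `zⱼ`; they
are coprime if the `α_k` are pairwise distinct. -/
def stepPair {n : ℕ} (α : Fin n → ℂ) (z : Fin n → P1) (i : Fin n) : ℂ × ℂ :=
  (∑ k, α k * (∏ l ∈ Finset.univ.erase k, br (z i) (α l)) *
        (∏ j ∈ Finset.univ.erase i, br (z i) (z j))
      - ∑ j ∈ Finset.univ.erase i, (hom (z j)).1 * (∏ k, br (z i) (α k)) *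
        (∏ l ∈ (Finset.univ.erase i).erase j, br (z i) (z l)),
   ∑ k, (∏ l ∈ Finset.univ.erase k, br (z i) (α l)) *
        (∏ j ∈ Finset.univ.erase i, br (z i) (z j))
      - ∑ j ∈ Finset.univ.erase i, (hom (z j)).2 * (∏ k, br (z i) (α k)) *
        (∏ l ∈ (Finset.univ.erase i).erase j, br (z i) (z l)))

/-- `z` is not in the indeterminacy locus of the Jacobi Ehrlich–Aberth map of `(ℙ¹)ⁿ`. -/
def Defined {n : ℕ} (α : Fin n → ℂ) (z : Fin n → P1) : Prop := ∀ i, stepPair α z i ≠ 0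

/-- The Jacobi Ehrlich–Aberth map `(ℙ¹)ⁿ ⇢ (ℙ¹)ⁿ` of the polynomial `∏ (X - αᵢ)`, meaningful at
the points where it is `Defined`. -/
def JEA {n : ℕ} (α : Fin n → ℂ) (z : Fin n → P1) : Fin n → P1 := fun i => ofHom (stepPair α z i)

/-- `x` is an orbit of the Jacobi Ehrlich–Aberth map in `(ℙ¹)ⁿ`. -/
def IsOrbit {n : ℕ} (α : Fin n → ℂ) (x : ℕ → Fin n → P1) : Prop :=
  ∀ k, Defined α (x k) ∧ x (k + 1) = JEA α (x k)

/-- `(z, z')` is a two-cycle of the Jacobi Ehrlich–Aberth map. -/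
def IsTwoCycle {n : ℕ} (α : Fin n → ℂ) (z z' : Fin n → P1) : Prop :=
  Defined α z ∧ Defined α z' ∧ JEA α z = z' ∧ JEA α z' = z ∧ z ≠ z'

@[simp] theorem hom_coe (t : ℂ) : hom (t : P1) = (t, 1) := rfl

@[simp] theorem hom_infty : hom (∞ : P1) = (1, 0) := rfl

@[simp] theorem br_coe (s t : ℂ) : br (s : P1) (t : P1) = s - t := by simp [br]

theorem hasDerivAt_prod_sub {n : ℕ} (s : Finset (Fin n)) (a : Fin n → ℂ) (t : ℂ) :
    HasDerivAt (fun x : ℂ => ∏ k ∈ s, (x - a k)) (∑ k ∈ s, ∏ l ∈ s.erase k, (t - a l)) t := by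
  have h := HasDerivAt.fun_finsetProd (u := s) (x := t) (f := fun k (x : ℂ) => x - a k)
    (f' := fun _ => 1) (fun k _ => (hasDerivAt_id t).sub_const (a k))
  simpa using h

theorem sum_root_mul {n : ℕ} (s : Finset (Fin n)) (a : Fin n → ℂ) (t : ℂ) :
    ∑ k ∈ s, a k * ∏ l ∈ s.erase k, (t - a l)
      = t * (∑ k ∈ s, ∏ l ∈ s.erase k, (t - a l)) - s.card * ∏ k ∈ s, (t - a k) := by
  have : ∀ k ∈ s, a k * ∏ l ∈ s.erase k, (t - a l)
      = t * ∏ l ∈ s.erase k, (t - a l) - ∏ l ∈ s, (t - a l) := by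
    intro k hk
    rw [← Finset.mul_prod_erase s (fun l => t - a l) hk]
    ring
  rw [Finset.sum_congr rfl this, Finset.sum_sub_distrib, Finset.mul_sum]
  simp

/-- The map `JEA` of `(ℙ¹)ⁿ` extends the Ehrlich–Aberth step of `ℂⁿ`. -/
theorem IsAffineStep.jea {n : ℕ} {α z z' : Fin n → ℂ} (h : IsAffineStep (rootPoly α) z z') :
    Defined α (incl z) ∧ JEA α (incl z) = incl z' := by
  have key : ∀ i, (stepPair α (incl z) i).2 ≠ 0 ∧
      (stepPair α (incl z) i).1 / (stepPair α (incl z) i).2 = z' i := by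
    intro i
    obtain ⟨hne, hq, hz⟩ := h i
    set t := z i with ht
    set P : ℂ := ∏ k, (t - α k) with hP
    set P' : ℂ := ∑ k, ∏ l ∈ Finset.univ.erase k, (t - α l) with hP'
    set W : ℂ := ∏ j ∈ Finset.univ.erase i, (t - z j) with hW
    set W' : ℂ := ∑ j ∈ Finset.univ.erase i,
      ∏ l ∈ (Finset.univ.erase i).erase j, (t - z l) with hW'
    have hW0 : W ≠ 0 := by
      rw [hW, Finset.prod_ne_zero_iff]
      intro j hj
      exact sub_ne_zero.mpr (hne j (Finset.ne_of_mem_erase hj))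
    have hqf : q (rootPoly α) z i = fun x =>
        (∏ k, (x - α k)) / ∏ j ∈ Finset.univ.erase i, (x - z j) := by
      funext x
      simp [q, rootPoly, eval_prod]
    have hd : deriv (q (rootPoly α) z i) t = (P' * W - P * W') / W ^ 2 := by
      rw [hqf]
      exact ((hasDerivAt_prod_sub Finset.univ α t).div
        (hasDerivAt_prod_sub (Finset.univ.erase i) z t) hW0).deriv
    have hv : q (rootPoly α) z i t = P / W := by rw [hqf]
    have hcard : (((Finset.univ.erase i).card : ℕ) : ℂ) = (n : ℂ) - 1 := by
      rw [Finset.card_erase_of_mem (Finset.mem_univ i), Finset.card_univ, Fintype.card_fin,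
        Nat.cast_sub (Nat.one_le_iff_ne_zero.mpr (by have := i.2; omega))]
      simp
    have h2 : (stepPair α (incl z) i).2 = P' * W - P * W' := by
      simp only [stepPair, incl, br_coe, hom_coe, one_mul, ← ht]
      rw [← Finset.sum_mul, ← Finset.mul_sum]
    have h1 : (stepPair α (incl z) i).1 = t * (P' * W - P * W') - P * W := by
      have e1 := sum_root_mul Finset.univ α t
      have e2 := sum_root_mul (Finset.univ.erase i) z t
      rw [← hP, ← hP', Finset.card_univ, Fintype.card_fin] at e1
      rw [← hW, ← hW', hcard] at e2
      simp only [stepPair, incl, br_coe, hom_coe, ← ht]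
      rw [← Finset.sum_mul, e1]
      have : ∀ j ∈ Finset.univ.erase i, z j * (∏ k, (t - α k)) *
          (∏ l ∈ (Finset.univ.erase i).erase j, (t - z l))
          = P * (z j * ∏ l ∈ (Finset.univ.erase i).erase j, (t - z l)) := by
        intro j _
        rw [← hP]; ring
      rw [Finset.sum_congr rfl this, ← Finset.mul_sum, e2]
      ring
    have hD : P' * W - P * W' ≠ 0 := by
      intro h0
      rw [hd, h0, zero_div] at hq
      exact hq rfl
    refine ⟨by rw [h2]; exact hD, ?_⟩
    rw [h1, h2, hz, hd, hv]
    field_simp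
  refine ⟨fun i h0 => (key i).1 (by rw [h0]; rfl), ?_⟩
  funext i
  rw [JEA, ofHom, if_neg (key i).1, (key i).2]
  rfl

/-! ### Coordinates on `(ℙ¹)ⁿ`, multipliers, stable manifolds -/

/-- The standard coordinate of `ℙ¹` near `c`: it is `z ↦ z` if `c ≠ ∞`, and `z ↦ 1 / z` if
`c = ∞`. -/
def chart1 (c x : P1) : ℂ :=
  c.elim ((hom x).2 / (hom x).1) (fun _ => (hom x).1 / (hom x).2)

/-- The inverse of `chart1 c`, a holomorphic open embedding `ℂ → ℙ¹`. -/
def chart1Inv (c : P1) (t : ℂ) : P1 := c.elim (ofHom (1, t)) (fun _ => ofHom (t, 1))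

/-- The product coordinates of `(ℙ¹)ⁿ` near `c`. -/
def chart {n : ℕ} (c x : Fin n → P1) : Fin n → ℂ := fun i => chart1 (c i) (x i)

/-- The inverse of `chart c`. -/
def chartInv {n : ℕ} (c : Fin n → P1) (t : Fin n → ℂ) : Fin n → P1 :=
  fun i => chart1Inv (c i) (t i)

theorem chart_chartInv {n : ℕ} (c : Fin n → P1) (t : Fin n → ℂ) : chart c (chartInv c t) = t := by
  funext i
  simp only [chart, chartInv, chart1, chart1Inv]
  generalize c i = x
  induction x using OnePoint.rec <;> by_cases ht : t i = 0 <;> simp [ofHom, ht]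

theorem chartInv_chart_self {n : ℕ} (c : Fin n → P1) : chartInv c (chart c c) = c := by
  funext i
  simp only [chart, chartInv, chart1, chart1Inv]
  generalize c i = x
  induction x using OnePoint.rec <;> simp [ofHom]

/-- The second iterate of the Jacobi Ehrlich–Aberth map in the coordinates near `c`. -/
def localReturn {n : ℕ} (α : Fin n → ℂ) (c : Fin n → P1) (t : Fin n → ℂ) : Fin n → ℂ :=
  chart c (JEA α (JEA α (chartInv c t)))

/-- An invertible linear map without eigenvalues on the unit circle, that has precisely one
eigenvalue, counted with multiplicity, in the open unit disc. -/
def IsHyperbolicOneAttracting {n : ℕ} (L : (Fin n → ℂ) →L[ℂ] (Fin n → ℂ)) : Prop :=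
  (∀ μ ∈ L.toLinearMap.charpoly.roots, μ ≠ 0 ∧ ‖μ‖ ≠ 1) ∧
    (L.toLinearMap.charpoly.roots.filter (fun μ => ‖μ‖ < 1)).card = 1

/-- The local stable set, relative to the neighbourhood `N`, of a point `c` of period two: the
points whose forward orbit is defined, lies in `N` at all even times, and converges to `c` along
the even times. -/
def localStableSet {n : ℕ} (α : Fin n → ℂ) (c : Fin n → P1) (N : Set (Fin n → P1)) :
    Set (Fin n → P1) :=
  {x₀ | ∃ x : ℕ → Fin n → P1, IsOrbit α x ∧ x 0 = x₀ ∧ (∀ k, x (2 * k) ∈ N) ∧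
    Tendsto (fun k => x (2 * k)) atTop (𝓝 c)}

/-- `γ` is a holomorphic embedding of the open unit disc into `ℂⁿ`. -/
def IsHolomorphicDisc {n : ℕ} (γ : ℂ → Fin n → ℂ) : Prop :=
  DifferentiableOn ℂ γ (Metric.ball 0 1) ∧ (∀ s ∈ Metric.ball (0 : ℂ) 1, deriv γ s ≠ 0) ∧
    IsEmbedding ((Metric.ball (0 : ℂ) 1).domRestrict γ)

/-- The disc `γ`, written in the coordinates near `c`, is a local stable manifold of the point `c`
of period two: it passes through `c`, it is the local stable set of `c` relative to some open
neighbourhood, and it is tangent at `c` to an attracting eigenvector of the derivative `L` of the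
second iterate. -/
def IsLocalStableDisc {n : ℕ} (α : Fin n → ℂ) (c : Fin n → P1)
    (L : (Fin n → ℂ) →L[ℂ] (Fin n → ℂ)) (γ : ℂ → Fin n → ℂ) : Prop :=
  IsHolomorphicDisc γ ∧ γ 0 = chart c c ∧
    (∃ N : Set (Fin n → P1), IsOpen N ∧ c ∈ N ∧
      (fun s => chartInv c (γ s)) '' Metric.ball 0 1 = localStableSet α c N) ∧
    ∃ μ : ℂ, ‖μ‖ < 1 ∧ L (deriv γ 0) = μ • deriv γ 0

/-! ### Parallelograms -/

/-- The cross-ratio, in the normalization `CR(0, ∞, c, d) = c / d`. -/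
def CR (a b c d : ℂ) : ℂ := ((a - c) * (b - d)) / ((a - d) * (b - c))

/-- Four pairwise distinct points that are, in this cyclic order, the vertices of a parallelogram
(which may be degenerate, that is, contained in a line). -/
def IsParallelogram (α : Fin 4 → ℂ) : Prop :=
  Function.Injective α ∧ α 0 + α 2 = α 1 + α 3

end EA

end

/-!
Away from collisions the Jacobi Ehrlich–Aberth map is given in homogeneous coordinates
`v i = [x : y]` by `∑ k, (α k, 1) / [v i, α k] - ∑ j ≠ i, v j / [v i, v j]`. For the parallelogram
with centre `m` and half-diagonals `a` and `b`, and for `c ^ 2 = a * b`, it maps the point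
`(∞, m, m + c, m - c)` to the point with coordinates `0 ↔ 1` and `2 ↔ 3` exchanged. As the map
commutes with permutations of the coordinates, this point lies on a two-cycle and is a fixed point
of the map followed by the permutation, whose square is the second iterate.

The eigenvalues of the derivative of the composition depend only on `w = -2 (a - b)² / c²`, which is
`8 - 8 / CR`: two of them are `1 - w` and `1 - 64 / w`, the other two have sum `w + 64 / w - 6` and
product `57 - 3 (w + 64 / w)`. Near `w = 4`, that is, near `CR = 2`, precisely one of them lies in
the unit disc and none on its boundary, and a graph transform yields the stable disc. Along its
orbits the coordinates `1 / z` at the infinite entries tend to zero without ever vanishing, because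
the attracting eigenvector is not tangent to infinity.
-/

noncomputable section

namespace EA

theorem exists_forall_dist_le_of_le_geometric {X Y : Type*} [PseudoMetricSpace Y] [CompleteSpace Y]
    {s : Set X} {Φ : ℕ → X → Y} {c κ : ℝ} (hκ : κ < 1)
    (h : ∀ n, ∀ x ∈ s, dist (Φ n x) (Φ (n + 1) x) ≤ c * κ ^ n) :
    ∃ f : X → Y, ∀ n, ∀ x ∈ s, dist (Φ n x) (f x) ≤ c * κ ^ n / (1 - κ) := by
  have limit : ∀ x, x ∈ s → ∃ y, Tendsto (Φ · x) atTop (𝓝 y) := fun x hx =>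
    cauchySeq_tendsto_of_complete (cauchySeq_of_le_geometric κ c hκ (h · x hx))
  rcases isEmpty_or_nonempty Y with _ | _
  · exact ⟨fun x => Φ 0 x, fun n x _ => isEmptyElim (Φ 0 x)⟩
  choose! f hf using limit
  exact ⟨f, fun n x hx => dist_le_of_le_geometric_of_tendsto κ c hκ (h · x hx) (hf x hx) n⟩

section Saddle

open scoped NNReal

variable {F : Type*} [NormedAddCommGroup F] [NormedSpace ℂ F]

/-- On the ball of radius `r` about the fixed point `0`, the map `g` is holomorphic and `ε`-close,
in the Lipschitz sense, to `(a, y) ↦ (l a, B y)`, where `l` is contracting and `B` is expanding.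
The numerical conditions make the graph transform a contraction. -/
structure IsSaddle (g : ℂ × F → ℂ × F) (l : ℂ) (B : F ≃L[ℂ] F) (r : ℝ) (ε : ℝ≥0) : Prop where
  r_pos : 0 < r
  map_zero : g 0 = 0
  contracting : ‖l‖ + 2 * ε < 1
  expanding : ‖(B.symm : F →L[ℂ] F)‖ + 2 * ε < 1
  lt_norm : ε < ‖l‖
  differentiableOn : DifferentiableOn ℂ g (Metric.ball 0 r)
  approximates :
    ApproximatesLinearOn g ((l • ContinuousLinearMap.id ℂ ℂ).prodMap (B : F →L[ℂ] F))
      (Metric.ball 0 r) ε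

/-- The functions on the disc of radius `r` among which the stable manifold of a saddle is sought:
holomorphic, vanishing at `0`, with Lipschitz constant `1`. -/
structure IsGraph (r : ℝ) (f : ℂ → F) : Prop where
  map_zero : f 0 = 0
  differentiableOn : DifferentiableOn ℂ f (Metric.ball 0 r)
  lipschitzOnWith : LipschitzOnWith 1 f (Metric.ball 0 r)

/-- The action of `g` on the graph of `f`, read off in the first coordinate. -/
def baseMap (g : ℂ × F → ℂ × F) (f : ℂ → F) (a : ℂ) : ℂ := (g (a, f a)).1

/-- The graph transform: its fixed points are the functions whose graph is invariant under `g`. -/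
def graphTransform (g : ℂ × F → ℂ × F) (B : F ≃L[ℂ] F) (f : ℂ → F) (a : ℂ) : F :=
  B.symm (f (baseMap g f a) - ((g (a, f a)).2 - B (f a)))

/-- The graph of `f` over the disc of radius `r` is mapped by `g` into the graph of `f`. -/
structure IsInvariantGraph (g : ℂ × F → ℂ × F) (r : ℝ) (f : ℂ → F) : Prop
    extends IsGraph r f where
  map_graph : ∀ a ∈ Metric.ball (0 : ℂ) r, g (a, f a) = (baseMap g f a, f (baseMap g f a))

variable {g : ℂ × F → ℂ × F} {l : ℂ} {B : F ≃L[ℂ] F} {r : ℝ} {ε : ℝ≥0} {f f₁ f₂ : ℂ → F} {a b : ℂ}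

theorem exists_isSaddle (map_zero : g 0 = 0) (hl₀ : l ≠ 0) (hl : ‖l‖ < 1)
    (hB : ‖(B.symm : F →L[ℂ] F)‖ < 1) (hd : ∀ᶠ p in 𝓝 0, DifferentiableAt ℂ g p)
    (hg : HasStrictFDerivAt g ((l • ContinuousLinearMap.id ℂ ℂ).prodMap (B : F →L[ℂ] F)) 0)
    {V : Set (ℂ × F)} (hV : V ∈ 𝓝 0) :
    ∃ r ε, IsSaddle g l B r ε ∧ Metric.ball 0 r ⊆ V := by
  have small_contracting : ∀ᶠ ε : ℝ in 𝓝[>] 0, ‖l‖ + 2 * ε < 1 :=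
    eventually_nhdsWithin_of_eventually_nhds
      (ContinuousAt.eventually_lt (by fun_prop) continuousAt_const (by simpa using hl))
  have small_expanding : ∀ᶠ ε : ℝ in 𝓝[>] 0, ‖(B.symm : F →L[ℂ] F)‖ + 2 * ε < 1 :=
    eventually_nhdsWithin_of_eventually_nhds
      (ContinuousAt.eventually_lt (by fun_prop) continuousAt_const (by simpa using hB))
  have small_lt_norm : ∀ᶠ ε : ℝ in 𝓝[>] 0, ε < ‖l‖ :=
    eventually_nhdsWithin_of_eventually_nhds (eventually_lt_nhds (norm_pos_iff.2 hl₀))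
  obtain ⟨ε, contracting, expanding, lt_norm, ε_pos⟩ := (small_contracting.and
    (small_expanding.and (small_lt_norm.and self_mem_nhdsWithin))).exists
  lift ε to ℝ≥0 using (Set.mem_Ioi.1 ε_pos).le
  obtain ⟨s, hs, approximates⟩ := hg.approximates_deriv_on_nhds
    (c := ε) (Or.inr (by simpa using ε_pos))
  obtain ⟨r, r_pos, ball_subset⟩ := Metric.mem_nhds_iff.1 (inter_mem (inter_mem hs hd) hV)
  exact ⟨r, ε, ⟨r_pos, map_zero, contracting, expanding, lt_norm,
    fun p hp => (ball_subset hp).1.2.differentiableWithinAt,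
    approximates.mono_set fun p hp => (ball_subset hp).1.1⟩, fun p hp => (ball_subset hp).2⟩

namespace IsGraph

theorem norm_apply_sub_le (hf : IsGraph r f) (ha : a ∈ Metric.ball 0 r)
    (hb : b ∈ Metric.ball 0 r) : ‖f a - f b‖ ≤ ‖a - b‖ := by
  simpa using hf.lipschitzOnWith.norm_sub_le ha hb

theorem norm_apply_le (hf : IsGraph r f) (ha : a ∈ Metric.ball 0 r) : ‖f a‖ ≤ ‖a‖ := by
  have hr : 0 < r := (norm_nonneg a).trans_lt (by simpa using ha)
  simpa [hf.map_zero] using hf.norm_apply_sub_le ha (Metric.mem_ball_self hr)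

theorem mem_ball (hf : IsGraph r f) (ha : a ∈ Metric.ball 0 r) :
    (a, f a) ∈ Metric.ball (0 : ℂ × F) r := by
  have hfa := hf.norm_apply_le ha
  rw [mem_ball_zero_iff] at ha ⊢
  exact max_lt ha (hfa.trans_lt ha)

theorem norm_mk_sub_mk (hf : IsGraph r f) (ha : a ∈ Metric.ball 0 r)
    (hb : b ∈ Metric.ball 0 r) : ‖((a, f a) : ℂ × F) - (b, f b)‖ = ‖a - b‖ :=
  max_eq_left (hf.norm_apply_sub_le ha hb)

theorem of_tendstoUniformlyOn {Φ : ℕ → ℂ → F} [CompleteSpace F] (hr : 0 < r)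
    (hΦ : ∀ n, IsGraph r (Φ n)) (h : TendstoUniformlyOn Φ f atTop (Metric.ball 0 r)) :
    IsGraph r f where
  map_zero := by
    refine tendsto_nhds_unique (h.tendsto_at (Metric.mem_ball_self hr)) ?_
    simp only [(hΦ _).map_zero, tendsto_const_nhds]
  differentiableOn := h.tendstoLocallyUniformlyOn.differentiableOn
    (Eventually.of_forall fun n => (hΦ n).differentiableOn) Metric.isOpen_ball
  lipschitzOnWith := LipschitzOnWith.of_dist_le_mul fun a ha b hb =>
    le_of_tendsto ((h.tendsto_at ha).dist (h.tendsto_at hb))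
      (Eventually.of_forall fun n => (hΦ n).lipschitzOnWith.dist_le_mul a ha b hb)

end IsGraph

namespace IsSaddle

theorem norm_fst_sub_le (H : IsSaddle g l B r ε) {p q : ℂ × F} (hp : p ∈ Metric.ball 0 r)
    (hq : q ∈ Metric.ball 0 r) :
    ‖(g p).1 - (g q).1 - l * (p.1 - q.1)‖ ≤ ε * ‖p - q‖ :=
  (norm_fst_le _).trans (H.approximates p hp q hq)

theorem norm_snd_sub_le (H : IsSaddle g l B r ε) {p q : ℂ × F} (hp : p ∈ Metric.ball 0 r)
    (hq : q ∈ Metric.ball 0 r) :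
    ‖(g p).2 - (g q).2 - B (p.2 - q.2)‖ ≤ ε * ‖p - q‖ :=
  (norm_snd_le _).trans (H.approximates p hp q hq)

theorem norm_symm_le_one (H : IsSaddle g l B r ε) : ‖(B.symm : F →L[ℂ] F)‖ ≤ 1 := by
  linarith [H.expanding, ε.coe_nonneg]

theorem zero_mem_ball (H : IsSaddle g l B r ε) : (0 : ℂ) ∈ Metric.ball (0 : ℂ) r :=
  Metric.mem_ball_self H.r_pos

theorem norm_baseMap_sub_sub_le (H : IsSaddle g l B r ε) (hf : IsGraph r f)
    (ha : a ∈ Metric.ball 0 r) (hb : b ∈ Metric.ball 0 r) :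
    ‖baseMap g f a - baseMap g f b - l * (a - b)‖ ≤ ε * ‖a - b‖ := by
  rw [← hf.norm_mk_sub_mk ha hb]
  exact H.norm_fst_sub_le (hf.mem_ball ha) (hf.mem_ball hb)

theorem norm_baseMap_sub_le (H : IsSaddle g l B r ε) (hf : IsGraph r f)
    (ha : a ∈ Metric.ball 0 r) (hb : b ∈ Metric.ball 0 r) :
    ‖baseMap g f a - baseMap g f b‖ ≤ (‖l‖ + ε) * ‖a - b‖ := by
  have near := H.norm_baseMap_sub_sub_le hf ha hb
  have triangle := norm_sub_norm_le (baseMap g f a - baseMap g f b) (l * (a - b))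
  rw [norm_mul] at triangle
  linarith

theorem baseMap_zero (H : IsSaddle g l B r ε) (hf : IsGraph r f) : baseMap g f 0 = 0 := by
  rw [baseMap, hf.map_zero, ← Prod.zero_eq_mk, H.map_zero, Prod.fst_zero]

theorem norm_baseMap_le (H : IsSaddle g l B r ε) (hf : IsGraph r f)
    (ha : a ∈ Metric.ball 0 r) : ‖baseMap g f a‖ ≤ (‖l‖ + ε) * ‖a‖ := by
  simpa [H.baseMap_zero hf] using H.norm_baseMap_sub_le hf ha H.zero_mem_ball

theorem baseMap_mem_ball (H : IsSaddle g l B r ε) (hf : IsGraph r f)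
    (ha : a ∈ Metric.ball 0 r) : baseMap g f a ∈ Metric.ball 0 r := by
  have rate_le : ‖l‖ + ε ≤ 1 := by linarith [H.contracting, ε.coe_nonneg]
  have shrink := (H.norm_baseMap_le hf ha).trans (mul_le_of_le_one_left (norm_nonneg a) rate_le)
  rw [mem_ball_zero_iff] at ha ⊢
  exact shrink.trans_lt ha

theorem baseMap_ne_zero (H : IsSaddle g l B r ε) (hf : IsGraph r f)
    (ha : a ∈ Metric.ball 0 r) (ha₀ : a ≠ 0) : baseMap g f a ≠ 0 := by
  intro h
  have near := H.norm_baseMap_sub_sub_le hf ha H.zero_mem_ball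
  rw [H.baseMap_zero hf, h, sub_zero, zero_sub, norm_neg, norm_mul, sub_zero] at near
  exact H.lt_norm.not_ge (le_of_mul_le_mul_right near (norm_pos_iff.2 ha₀))

theorem isGraph_graphTransform (H : IsSaddle g l B r ε) (hf : IsGraph r f) :
    IsGraph r (graphTransform g B f) where
  map_zero := by
    rw [graphTransform, H.baseMap_zero hf, hf.map_zero, ← Prod.zero_eq_mk, H.map_zero]
    simp
  differentiableOn := by
    have image : DifferentiableOn ℂ (fun a => g (a, f a)) (Metric.ball 0 r) :=
      H.differentiableOn.comp (differentiableOn_id.prodMk hf.differentiableOn)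
        fun a ha => hf.mem_ball ha
    exact B.symm.differentiable.comp_differentiableOn (DifferentiableOn.sub
      (hf.differentiableOn.comp image.fst fun a ha => H.baseMap_mem_ball hf ha)
      (image.snd.sub (B.differentiable.comp_differentiableOn hf.differentiableOn)))
  lipschitzOnWith := by
    refine LipschitzOnWith.of_dist_le_mul fun a ha b hb => ?_
    rw [dist_eq_norm, dist_eq_norm, NNReal.coe_one, one_mul]
    have graph_le := hf.norm_apply_sub_le (H.baseMap_mem_ball hf ha) (H.baseMap_mem_ball hf hb)
    have base_le := H.norm_baseMap_sub_le hf ha hb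
    have fibre_le := H.norm_snd_sub_le (hf.mem_ball ha) (hf.mem_ball hb)
    rw [hf.norm_mk_sub_mk ha hb] at fibre_le
    calc ‖graphTransform g B f a - graphTransform g B f b‖
        = ‖B.symm ((f (baseMap g f a) - f (baseMap g f b))
            - ((g (a, f a)).2 - (g (b, f b)).2 - B (f a - f b)))‖ := by
          simp only [graphTransform, ← map_sub]
          rw [map_sub B]
          congr 2
          abel
      _ ≤ ‖(f (baseMap g f a) - f (baseMap g f b))
            - ((g (a, f a)).2 - (g (b, f b)).2 - B (f a - f b))‖ :=
          (B.symm : F →L[ℂ] F).le_of_opNorm_le_of_le H.norm_symm_le_one le_rfl |>.trans_eq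
            (one_mul _)
      _ ≤ (‖l‖ + ε) * ‖a - b‖ + ε * ‖a - b‖ :=
          (norm_sub_le _ _).trans (add_le_add (graph_le.trans base_le) fibre_le)
      _ ≤ ‖a - b‖ := by nlinarith [H.contracting, norm_nonneg (a - b)]

theorem dist_graphTransform_le (H : IsSaddle g l B r ε) (hf₁ : IsGraph r f₁)
    (hf₂ : IsGraph r f₂) {δ : ℝ} (hδ : ∀ a ∈ Metric.ball (0 : ℂ) r, dist (f₁ a) (f₂ a) ≤ δ)
    (ha : a ∈ Metric.ball 0 r) :
    dist (graphTransform g B f₁ a) (graphTransform g B f₂ a) ≤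
      ‖(B.symm : F →L[ℂ] F)‖ * (1 + 2 * ε) * δ := by
  simp only [dist_eq_norm] at hδ ⊢
  have vertical : ‖((a, f₁ a) : ℂ × F) - (a, f₂ a)‖ ≤ δ := by
    simpa [Prod.norm_def] using hδ a ha
  have base_le : ‖baseMap g f₁ a - baseMap g f₂ a‖ ≤ ε * δ := by
    have := H.norm_fst_sub_le (hf₁.mem_ball ha) (hf₂.mem_ball ha)
    rw [sub_self, mul_zero, sub_zero] at this
    exact this.trans (mul_le_mul_of_nonneg_left vertical ε.coe_nonneg)
  have fibre_le : ‖(g (a, f₁ a)).2 - (g (a, f₂ a)).2 - B (f₁ a - f₂ a)‖ ≤ ε * δ :=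
    (H.norm_snd_sub_le (hf₁.mem_ball ha) (hf₂.mem_ball ha)).trans
      (mul_le_mul_of_nonneg_left vertical ε.coe_nonneg)
  have graph_le := (hf₁.norm_apply_sub_le (H.baseMap_mem_ball hf₁ ha)
    (H.baseMap_mem_ball hf₂ ha)).trans base_le
  calc ‖graphTransform g B f₁ a - graphTransform g B f₂ a‖
      = ‖B.symm (((f₁ (baseMap g f₁ a) - f₁ (baseMap g f₂ a))
          + (f₁ (baseMap g f₂ a) - f₂ (baseMap g f₂ a)))
          - ((g (a, f₁ a)).2 - (g (a, f₂ a)).2 - B (f₁ a - f₂ a)))‖ := by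
        simp only [graphTransform, ← map_sub]
        rw [map_sub B]
        congr 2
        abel
    _ ≤ ‖(B.symm : F →L[ℂ] F)‖ * (ε * δ + δ + ε * δ) :=
        (B.symm : F →L[ℂ] F).le_opNorm_of_le <| (norm_sub_le _ _).trans <|
          add_le_add ((norm_add_le _ _).trans (add_le_add graph_le
            (hδ _ (H.baseMap_mem_ball hf₂ ha)))) fibre_le
    _ = ‖(B.symm : F →L[ℂ] F)‖ * (1 + 2 * ε) * δ := by ring

theorem isGraph_iterate_graphTransform (H : IsSaddle g l B r ε) (n : ℕ) :
    IsGraph r ((graphTransform g B)^[n] 0) := by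
  induction n with
  | zero => exact ⟨rfl, differentiableOn_const _, (LipschitzWith.const _).lipschitzOnWith.weaken
      zero_le_one⟩
  | succ n ih => rw [Function.iterate_succ_apply']; exact H.isGraph_graphTransform ih

theorem dist_iterate_graphTransform_le (H : IsSaddle g l B r ε) (n : ℕ) :
    ∀ a ∈ Metric.ball (0 : ℂ) r,
      dist ((graphTransform g B)^[n] 0 a) ((graphTransform g B)^[n + 1] 0 a) ≤
        r * (‖(B.symm : F →L[ℂ] F)‖ * (1 + 2 * ε)) ^ n := by
  induction n with
  | zero =>
    intro a ha
    have first := (H.isGraph_iterate_graphTransform 1).norm_apply_le ha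
    rw [Function.iterate_zero_apply, Pi.zero_apply, dist_zero_left, pow_zero, mul_one]
    exact first.trans (mem_ball_zero_iff.1 ha).le
  | succ n ih =>
    intro a ha
    rw [Function.iterate_succ_apply', Function.iterate_succ_apply' _ (n + 1), pow_succ',
      mul_left_comm]
    exact H.dist_graphTransform_le (H.isGraph_iterate_graphTransform n)
      (H.isGraph_iterate_graphTransform (n + 1)) ih ha

end IsSaddle

theorem IsGraph.isInvariantGraph (hf : IsGraph r f)
    (hfix : ∀ a ∈ Metric.ball (0 : ℂ) r, graphTransform g B f a = f a) :
    IsInvariantGraph g r f where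
  toIsGraph := hf
  map_graph a ha := by
    have fibre := congrArg B (hfix a ha)
    rw [graphTransform, B.apply_symm_apply, sub_eq_iff_eq_add, add_sub_cancel] at fibre
    exact Prod.ext rfl fibre.symm

namespace IsSaddle

theorem exists_isInvariantGraph [CompleteSpace F] (H : IsSaddle g l B r ε) :
    ∃ f : ℂ → F, IsInvariantGraph g r f := by
  set κ : ℝ := ‖(B.symm : F →L[ℂ] F)‖ * (1 + 2 * ε)
  have κ_nonneg : 0 ≤ κ := by positivity
  have κ_lt_one : κ < 1 := by
    have := mul_le_of_le_one_left (mul_nonneg zero_le_two ε.coe_nonneg) H.norm_symm_le_one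
    linarith [H.expanding]
  obtain ⟨f, hf⟩ := exists_forall_dist_le_of_le_geometric κ_lt_one
    H.dist_iterate_graphTransform_le
  have bound_tendsto : Tendsto (fun n => r * κ ^ n / (1 - κ)) atTop (𝓝 0) := by
    simpa using ((tendsto_pow_atTop_nhds_zero_of_lt_one κ_nonneg κ_lt_one).const_mul r).div_const
      (1 - κ)
  have uniform : TendstoUniformlyOn (fun n => (graphTransform g B)^[n] 0) f atTop
      (Metric.ball 0 r) := by
    refine Metric.tendstoUniformlyOn_iff.2 fun δ hδ => ?_
    filter_upwards [bound_tendsto.eventually_lt_const hδ] with n hn a ha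
    rw [dist_comm]
    exact (hf n a ha).trans_lt hn
  have isGraph := IsGraph.of_tendstoUniformlyOn H.r_pos H.isGraph_iterate_graphTransform uniform
  refine ⟨f, isGraph.isInvariantGraph (B := B) fun a ha => ?_⟩
  have tendsto_transform :
      Tendsto (fun n => (graphTransform g B)^[n + 1] 0 a) atTop (𝓝 (graphTransform g B f a)) := by
    rw [tendsto_iff_dist_tendsto_zero]
    refine squeeze_zero (fun _ => dist_nonneg) (fun n => ?_)
      (by simpa using bound_tendsto.const_mul κ)
    rw [Function.iterate_succ_apply']
    exact H.dist_graphTransform_le (H.isGraph_iterate_graphTransform n) isGraph (hf n) ha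
  exact tendsto_nhds_unique tendsto_transform
    ((tendsto_add_atTop_iff_nat 1).2 (uniform.tendsto_at ha))

theorem map_deriv_graph (H : IsSaddle g l B r ε)
    (hg : HasFDerivAt g ((l • ContinuousLinearMap.id ℂ ℂ).prodMap (B : F →L[ℂ] F)) 0)
    (hf : IsInvariantGraph g r f) : B (deriv f 0) = l • deriv f 0 := by
  have ball_mem : Metric.ball (0 : ℂ) r ∈ 𝓝 0 := Metric.ball_mem_nhds 0 H.r_pos
  have graph_deriv : HasDerivAt f (deriv f 0) 0 :=
    (hf.differentiableOn.differentiableAt ball_mem).hasDerivAt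
  rw [Prod.zero_eq_mk, ← hf.map_zero] at hg
  have image_deriv : HasDerivAt (fun a => g (a, f a)) (l * 1, B (deriv f 0)) 0 :=
    HasFDerivAt.comp_hasDerivAt (f := fun a => (a, f a)) (0 : ℂ) hg
      ((hasDerivAt_id 0).prodMk graph_deriv)
  have base_deriv : HasDerivAt (baseMap g f) (l * 1) 0 := image_deriv.fst
  rw [mul_one] at base_deriv
  have comp_deriv : HasDerivAt (f ∘ baseMap g f) (l • deriv f 0) 0 :=
    HasDerivAt.scomp (0 : ℂ) (by rwa [H.baseMap_zero hf.toIsGraph]) base_deriv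
  have fibre_deriv : HasDerivAt (fun a => (g (a, f a)).2) (B (deriv f 0)) 0 := image_deriv.snd
  refine fibre_deriv.unique (comp_deriv.congr_of_eventuallyEq ?_)
  filter_upwards [ball_mem] with a ha
  exact congrArg Prod.snd (hf.map_graph a ha)

theorem hasDerivAt_graph (H : IsSaddle g l B r ε)
    (hg : HasFDerivAt g ((l • ContinuousLinearMap.id ℂ ℂ).prodMap (B : F →L[ℂ] F)) 0)
    (hf : IsInvariantGraph g r f) : HasDerivAt f 0 0 := by
  have graph_deriv : HasDerivAt f (deriv f 0) 0 :=
    (hf.differentiableOn.differentiableAt (Metric.ball_mem_nhds 0 H.r_pos)).hasDerivAt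
  have eq_symm : deriv f 0 = B.symm (l • deriv f 0) := by
    rw [← H.map_deriv_graph hg hf, B.symm_apply_apply]
  have norm_le : ‖deriv f 0‖ ≤ ‖l‖ * ‖deriv f 0‖ :=
    calc ‖deriv f 0‖ = ‖B.symm (l • deriv f 0)‖ := congrArg norm eq_symm
      _ ≤ 1 * ‖l • deriv f 0‖ :=
        (B.symm : F →L[ℂ] F).le_of_opNorm_le H.norm_symm_le_one _
      _ = ‖l‖ * ‖deriv f 0‖ := by rw [one_mul, norm_smul]
  have deriv_eq_zero : deriv f 0 = 0 := by
    have l_lt_one : ‖l‖ < 1 := by linarith [H.contracting, ε.coe_nonneg]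
    refine norm_le_zero_iff.1 ?_
    nlinarith [norm_nonneg (deriv f 0)]
  rwa [deriv_eq_zero] at graph_deriv

theorem unstableCone_map (H : IsSaddle g l B r ε) {p q : ℂ × F}
    (hp : p ∈ Metric.ball 0 r) (hq : q ∈ Metric.ball 0 r) (h : ‖p.1 - q.1‖ ≤ ‖p.2 - q.2‖) :
    ‖(g p).1 - (g q).1‖ ≤ ‖(g p).2 - (g q).2‖ ∧
      (1 - ε) * ‖p.2 - q.2‖ ≤ ‖(B.symm : F →L[ℂ] F)‖ * ‖(g p).2 - (g q).2‖ := by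
  have steep : ‖p - q‖ = ‖p.2 - q.2‖ := max_eq_right h
  have base_le : ‖(g p).1 - (g q).1‖ ≤ ‖l‖ * ‖p.2 - q.2‖ + ε * ‖p.2 - q.2‖ := by
    have near := H.norm_fst_sub_le hp hq
    have triangle := norm_sub_norm_le ((g p).1 - (g q).1) (l * (p.1 - q.1))
    rw [norm_mul] at triangle
    rw [steep] at near
    linarith [mul_le_mul_of_nonneg_left h (norm_nonneg l)]
  have linear_le : ‖B (p.2 - q.2)‖ ≤ ‖(g p).2 - (g q).2‖ + ε * ‖p.2 - q.2‖ := by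
    have near := H.norm_snd_sub_le hp hq
    have triangle := norm_sub_norm_le (B (p.2 - q.2)) ((g p).2 - (g q).2)
    rw [norm_sub_rev (B _)] at triangle
    rw [steep] at near
    linarith
  have expand : (1 - ε) * ‖p.2 - q.2‖ ≤
      ‖(B.symm : F →L[ℂ] F)‖ * ‖(g p).2 - (g q).2‖ := by
    have inverse_le : ‖p.2 - q.2‖ ≤ ‖(B.symm : F →L[ℂ] F)‖ *
        (‖(g p).2 - (g q).2‖ + ε * ‖p.2 - q.2‖) := by
      simpa using (B.symm : F →L[ℂ] F).le_opNorm_of_le linear_le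
    have := mul_le_of_le_one_left (mul_nonneg ε.coe_nonneg (norm_nonneg (p.2 - q.2)))
      H.norm_symm_le_one
    linarith
  have shrink := mul_le_of_le_one_left (norm_nonneg ((g p).2 - (g q).2)) H.norm_symm_le_one
  exact ⟨by nlinarith [H.contracting, norm_nonneg (p.2 - q.2)], expand⟩

theorem iterate_graph (H : IsSaddle g l B r ε) (hf : IsInvariantGraph g r f)
    (ha : a ∈ Metric.ball 0 r) (k : ℕ) :
    ∃ b ∈ Metric.ball (0 : ℂ) r, g^[k] (a, f a) = (b, f b) ∧ ‖b‖ ≤ (‖l‖ + ε) ^ k * ‖a‖ ∧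
      (a ≠ 0 → b ≠ 0) := by
  induction k with
  | zero => exact ⟨a, ha, rfl, by simp, id⟩
  | succ k ih =>
    obtain ⟨b, hb, iterate_eq, norm_le, ne_zero⟩ := ih
    refine ⟨baseMap g f b, H.baseMap_mem_ball hf.toIsGraph hb, ?_, ?_,
      fun ha₀ => H.baseMap_ne_zero hf.toIsGraph hb (ne_zero ha₀)⟩
    · rw [Function.iterate_succ_apply', iterate_eq, hf.map_graph b hb]
    · refine (H.norm_baseMap_le hf.toIsGraph hb).trans ?_
      rw [pow_succ', mul_assoc]
      exact mul_le_mul_of_nonneg_left norm_le (by positivity)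

theorem iterate_graph_mem_ball (H : IsSaddle g l B r ε) (hf : IsInvariantGraph g r f)
    (ha : a ∈ Metric.ball 0 r) (k : ℕ) : g^[k] (a, f a) ∈ Metric.ball (0 : ℂ × F) r := by
  obtain ⟨b, hb, iterate_eq, -⟩ := H.iterate_graph hf ha k
  exact iterate_eq ▸ hf.mem_ball hb

theorem unstableCone_iterate (H : IsSaddle g l B r ε) {p q : ℂ × F}
    (hp : ∀ k, g^[k] p ∈ Metric.ball 0 r) (hq : ∀ k, g^[k] q ∈ Metric.ball 0 r)
    (h : ‖p.1 - q.1‖ ≤ ‖p.2 - q.2‖) (k : ℕ) :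
    ‖(g^[k] p).1 - (g^[k] q).1‖ ≤ ‖(g^[k] p).2 - (g^[k] q).2‖ ∧
      ‖p.2 - q.2‖ ≤ (‖(B.symm : F →L[ℂ] F)‖ / (1 - ε)) ^ k *
        ‖(g^[k] p).2 - (g^[k] q).2‖ := by
  have one_sub_pos : 0 < 1 - (ε : ℝ) := by
    linarith [H.expanding, norm_nonneg (B.symm : F →L[ℂ] F), ε.coe_nonneg]
  induction k with
  | zero => simpa using h
  | succ k ih =>
    obtain ⟨steep, expand⟩ := H.unstableCone_map (hp k) (hq k) ih.1
    rw [Function.iterate_succ_apply', Function.iterate_succ_apply']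
    refine ⟨steep, ih.2.trans ?_⟩
    rw [pow_succ, mul_assoc]
    gcongr
    rw [div_mul_eq_mul_div, le_div_iff₀' one_sub_pos]
    exact expand

/-- Otherwise `p` and the point of the graph with the same first coordinate differ by a vector of
the unstable cone, so that their orbits separate exponentially. -/
theorem snd_eq_of_iterates_mem_ball (H : IsSaddle g l B r ε) (hf : IsInvariantGraph g r f)
    {p : ℂ × F} (hp : ∀ k, g^[k] p ∈ Metric.ball (0 : ℂ × F) r) : p.2 = f p.1 := by
  have fst_mem : p.1 ∈ Metric.ball (0 : ℂ) r :=
    mem_ball_zero_iff.2 ((norm_fst_le p).trans_lt (mem_ball_zero_iff.1 (hp 0)))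
  have graph_mem := H.iterate_graph_mem_ball hf fst_mem
  set θ : ℝ := ‖(B.symm : F →L[ℂ] F)‖ / (1 - ε) with hθ
  have one_sub_pos : 0 < 1 - (ε : ℝ) := by
    linarith [H.expanding, norm_nonneg (B.symm : F →L[ℂ] F), ε.coe_nonneg]
  have θ_nonneg : 0 ≤ θ := by positivity
  have θ_lt_one : θ < 1 := by
    rw [hθ, div_lt_one one_sub_pos]
    linarith [H.expanding, ε.coe_nonneg]
  have bound (k : ℕ) : ‖p.2 - f p.1‖ ≤ θ ^ k * (r + r) := by
    refine (H.unstableCone_iterate hp graph_mem (by simp) k).2.trans ?_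
    gcongr
    exact (norm_sub_le _ _).trans <| add_le_add
      ((norm_snd_le _).trans (mem_ball_zero_iff.1 (hp k)).le)
      ((norm_snd_le _).trans (mem_ball_zero_iff.1 (graph_mem k)).le)
  have bound_tendsto : Tendsto (fun k => θ ^ k * (r + r)) atTop (𝓝 0) := by
    simpa using (tendsto_pow_atTop_nhds_zero_of_lt_one θ_nonneg θ_lt_one).mul_const (r + r)
  exact sub_eq_zero.1 (norm_le_zero_iff.1 (ge_of_tendsto' bound_tendsto bound))

end IsSaddle

end Saddle

section StableDisc

variable {E F : Type*} [NormedAddCommGroup E] [NormedSpace ℂ E] [NormedAddCommGroup F]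
  [NormedSpace ℂ F]

/-- The holomorphically embedded unit disc `γ`, centred at the point `b`, is the local stable
manifold of `b` under `G`: it consists of the points whose orbits stay in the open set `N`, and
these orbits converge to `b`. -/
structure IsStableDisc (G : E → E) (b : E) (N : Set E) (γ : ℂ → E) : Prop where
  differentiableOn : DifferentiableOn ℂ γ (Metric.ball 0 1)
  deriv_ne_zero : ∀ s ∈ Metric.ball (0 : ℂ) 1, deriv γ s ≠ 0
  isEmbedding : IsEmbedding ((Metric.ball (0 : ℂ) 1).domRestrict γ)
  map_zero : γ 0 = b
  isOpen : IsOpen N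
  image_eq : γ '' Metric.ball 0 1 = {x | ∀ k, G^[k] x ∈ N}
  tendsto : ∀ s ∈ Metric.ball (0 : ℂ) 1, Tendsto (fun k => G^[k] (γ s)) atTop (𝓝 b)

/-- The graph of `f` over the disc of radius `r`, parametrized by the unit disc. -/
def graphDisc (r : ℝ) (f : ℂ → F) (s : ℂ) : ℂ × F := (r * s, f (r * s))

theorem mul_mem_ball {r : ℝ} (hr : 0 < r) {s : ℂ} (hs : s ∈ Metric.ball 0 1) :
    (r : ℂ) * s ∈ Metric.ball 0 r := by
  rw [mem_ball_zero_iff] at hs ⊢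
  rw [norm_mul, Complex.norm_real, Real.norm_of_nonneg hr.le]
  exact mul_lt_of_lt_one_right hr hs

theorem hasDerivAt_graphDisc {r : ℝ} {f : ℂ → F} {s : ℂ} {f' : F} (hf : HasDerivAt f f' (r * s)) :
    HasDerivAt (graphDisc r f) (r • (1, f')) s := by
  have scale : HasDerivAt (fun s : ℂ => (r : ℂ) * s) (r : ℂ) s := by
    simpa using (hasDerivAt_id s).const_mul (r : ℂ)
  exact (scale.prodMk (hf.scomp s scale)).congr_deriv (by ext <;> simp)

theorem IsSaddle.isStableDisc_graphDisc {g : ℂ × F → ℂ × F} {l : ℂ} {B : F ≃L[ℂ] F} {r : ℝ}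
    {ε : NNReal} {f : ℂ → F} (H : IsSaddle g l B r ε) (hf : IsInvariantGraph g r f) :
    IsStableDisc g 0 (Metric.ball 0 r) (graphDisc r f) := by
  have r_ne_zero : (r : ℂ) ≠ 0 := by exact_mod_cast H.r_pos.ne'
  have hasDerivAt {s : ℂ} (hs : s ∈ Metric.ball 0 1) :
      HasDerivAt (graphDisc r f) (r • (1, deriv f (r * s))) s :=
    hasDerivAt_graphDisc (hf.differentiableOn.differentiableAt
      (Metric.isOpen_ball.mem_nhds (mul_mem_ball H.r_pos hs))).hasDerivAt
  have differentiableOn : DifferentiableOn ℂ (graphDisc r f) (Metric.ball 0 1) :=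
    fun s hs => (hasDerivAt hs).differentiableAt.differentiableWithinAt
  refine ⟨differentiableOn, fun s hs => ?_, ?_, ?_, Metric.isOpen_ball, ?_, fun s hs => ?_⟩
  · rw [(hasDerivAt hs).deriv]
    exact smul_ne_zero H.r_pos.ne' fun h => one_ne_zero (congrArg Prod.fst h)
  · refine IsEmbedding.of_comp differentiableOn.continuousOn.domRestrict continuous_fst ?_
    exact (Homeomorph.mulLeft₀ (r : ℂ) r_ne_zero).isEmbedding.comp IsEmbedding.subtypeVal
  · simp [graphDisc, hf.map_zero]
  · refine Set.Subset.antisymm ?_ fun p hp => ⟨p.1 / r, ?_, ?_⟩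
    · rintro _ ⟨s, hs, rfl⟩ k
      exact H.iterate_graph_mem_ball hf (mul_mem_ball H.r_pos hs) k
    · have fst_lt := (norm_fst_le p).trans_lt (mem_ball_zero_iff.1 (hp 0))
      rwa [mem_ball_zero_iff, norm_div, Complex.norm_real, Real.norm_of_nonneg H.r_pos.le,
        div_lt_one H.r_pos]
    · rw [graphDisc, mul_div_cancel₀ _ r_ne_zero, ← H.snd_eq_of_iterates_mem_ball hf hp]
  · have rate_lt_one : ‖l‖ + ε < 1 := by linarith [H.contracting, ε.coe_nonneg]
    refine squeeze_zero_norm (fun k => ?_) (a := fun k => (‖l‖ + ε) ^ k * ‖(r : ℂ) * s‖) ?_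
    · obtain ⟨b, hb, iterate_eq, norm_le, -⟩ := H.iterate_graph hf (mul_mem_ball H.r_pos hs) k
      rw [graphDisc, iterate_eq]
      exact (max_le le_rfl (hf.norm_apply_le hb)).trans norm_le
    · simpa using (tendsto_pow_atTop_nhds_zero_of_lt_one (by positivity) rate_lt_one).mul_const
        ‖(r : ℂ) * s‖

theorem iterate_conj_eq {g : F → F} {G : E → E} {b : E} {P : F ≃L[ℂ] E}
    (h : ∀ p, G (b + P p) = b + P (g p)) (k : ℕ) (p : F) : G^[k] (b + P p) = b + P (g^[k] p) :=
  ((show Function.Semiconj (fun p => b + P p) g G from fun p => (h p).symm).iterate_right k p).symm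

theorem hasDerivAt_add_apply {P : F ≃L[ℂ] E} {γ : ℂ → F} {γ' : F} {s : ℂ}
    (h : HasDerivAt γ γ' s) (b : E) : HasDerivAt (fun s => b + P (γ s)) (P γ') s :=
  (P.hasFDerivAt.comp_hasDerivAt s h).const_add b

theorem IsStableDisc.conj {g : F → F} {G : E → E} {b : E} {P : F ≃L[ℂ] E} {N : Set F}
    {γ : ℂ → F} (h : IsStableDisc g 0 N γ) (hG : ∀ p, G (b + P p) = b + P (g p)) :
    IsStableDisc G b ((fun x => P.symm (x - b)) ⁻¹' N) (fun s => b + P (γ s)) where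
  differentiableOn := (P.differentiable.comp_differentiableOn h.differentiableOn).const_add b
  deriv_ne_zero s hs := by
    have γ_deriv := (h.differentiableOn.differentiableAt
      (Metric.isOpen_ball.mem_nhds hs)).hasDerivAt
    rw [(hasDerivAt_add_apply γ_deriv b).deriv]
    exact (map_ne_zero_iff P P.injective).2 (h.deriv_ne_zero s hs)
  isEmbedding :=
    (P.toHomeomorph.trans (Homeomorph.addLeft b)).isEmbedding.comp h.isEmbedding
  map_zero := by rw [h.map_zero, _root_.map_zero, add_zero]
  isOpen := h.isOpen.preimage (P.symm.continuous.comp (continuous_id.sub continuous_const))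
  image_eq := by
    have orbit_mem (p : F) : (∀ k, G^[k] (b + P p) ∈ (fun x => P.symm (x - b)) ⁻¹' N) ↔
        p ∈ γ '' Metric.ball 0 1 := by
      rw [h.image_eq]
      simp [iterate_conj_eq hG]
    ext x
    obtain ⟨p, rfl⟩ : ∃ p, b + P p = x := ⟨P.symm (x - b), by simp⟩
    rw [Set.mem_ofPred_eq, orbit_mem]
    simp
  tendsto s hs := by
    simp only [iterate_conj_eq hG]
    simpa using ((P.continuous.tendsto 0).comp (h.tendsto s hs)).const_add b

theorem hasStrictFDerivAt_conj {G : E → E} {G' : E →L[ℂ] E} {b : E} {P : F ≃L[ℂ] E}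
    {L : F →L[ℂ] F} (hG : HasStrictFDerivAt G G' b) (hP : ∀ p, G' (P p) = P (L p)) :
    HasStrictFDerivAt (fun p => P.symm (G (b + P p) - b)) L 0 := by
  have translate_deriv : HasStrictFDerivAt (fun p => b + P p) (P : F →L[ℂ] E) 0 :=
    P.hasStrictFDerivAt.const_add b
  have G_deriv : HasStrictFDerivAt G G' (b + P 0) := by simpa using hG
  refine (P.symm.hasStrictFDerivAt.comp 0
    ((G_deriv.comp 0 translate_deriv).sub_const b)).congr_fderiv ?_
  exact ContinuousLinearMap.ext fun p => P.symm_apply_eq.2 (hP p)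

theorem exists_isStableDisc [CompleteSpace F] {G : E → E} {b : E} {P : (ℂ × F) ≃L[ℂ] E} {l : ℂ}
    {B : F ≃L[ℂ] F} (hl₀ : l ≠ 0) (hl : ‖l‖ < 1) (hB : ‖(B.symm : F →L[ℂ] F)‖ < 1)
    (hb : G b = b) (hG : ContDiffAt ℂ 1 G b)
    (hP : ∀ p, fderiv ℂ G b (P p) = P (l * p.1, B p.2)) {V : Set E} (hV : V ∈ 𝓝 b) :
    ∃ (N : Set E) (γ : ℂ → E) (r : ℝ), N ⊆ V ∧ IsStableDisc G b N γ ∧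
      deriv γ 0 = r • P (1, 0) ∧
      ∀ s ∈ Metric.ball (0 : ℂ) 1, s ≠ 0 → ∀ k, ∃ (a : ℂ) (y : F), a ≠ 0 ∧ ‖y‖ ≤ ‖a‖ ∧
        G^[k] (γ s) = b + P (a, y) := by
  set g : ℂ × F → ℂ × F := fun p => P.symm (G (b + P p) - b) with hg
  have conj (p : ℂ × F) : G (b + P p) = b + P (g p) := by simp [hg]
  have translate_tendsto : Tendsto (fun p => b + P p) (𝓝 0) (𝓝 b) :=
    (show Continuous fun p => b + P p by fun_prop).tendsto' 0 b (by simp)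
  have g_zero : g 0 = 0 := by simp [hg, hb]
  have g_differentiableAt : ∀ᶠ p in 𝓝 0, DifferentiableAt ℂ g p := by
    filter_upwards [translate_tendsto.eventually (hG.eventually (by simp))] with p hp
    exact P.symm.differentiableAt.comp p
      (((hp.differentiableAt one_ne_zero).comp p (P.differentiableAt.const_add b)).sub_const b)
  have g_deriv : HasStrictFDerivAt g
      ((l • ContinuousLinearMap.id ℂ ℂ).prodMap (B : F →L[ℂ] F)) 0 :=
    hasStrictFDerivAt_conj (hG.hasStrictFDerivAt one_ne_zero) hP
  obtain ⟨r, ε, saddle, ball_subset⟩ := exists_isSaddle g_zero hl₀ hl hB g_differentiableAt g_deriv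
    (translate_tendsto hV)
  obtain ⟨f, hf⟩ := saddle.exists_isInvariantGraph
  refine ⟨_, _, r, fun x hx => ?_, (saddle.isStableDisc_graphDisc hf).conj conj, ?_,
    fun s hs hs₀ k => ?_⟩
  · simpa using ball_subset hx
  · have disc_deriv : HasDerivAt (graphDisc r f) (r • (1, 0)) 0 := hasDerivAt_graphDisc
      (by rw [mul_zero]; exact saddle.hasDerivAt_graph g_deriv.hasFDerivAt hf)
    rw [(hasDerivAt_add_apply disc_deriv b).deriv]
    exact map_real_smul (P : ℂ × F →L[ℂ] E) P.continuous r (1, 0)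
  · obtain ⟨a, ha, iterate_eq, -, ne_zero⟩ :=
      saddle.iterate_graph hf (mul_mem_ball saddle.r_pos hs) k
    refine ⟨a, f a, ne_zero (mul_ne_zero (by exact_mod_cast saddle.r_pos.ne') hs₀),
      hf.norm_apply_le ha, ?_⟩
    rw [iterate_conj_eq conj, graphDisc, iterate_eq]

end StableDisc

section ProjectiveLine

theorem ofHom_smul {s : ℂ} (hs : s ≠ 0) (v : ℂ × ℂ) : ofHom (s • v) = ofHom v := by
  by_cases h : v.2 = 0
  · simp [ofHom, h]
  · simp [ofHom, h, hs, mul_div_mul_left]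

theorem ofHom_coe_one (t : ℂ) : ofHom (t, 1) = (t : P1) := by simp [ofHom]

theorem ofHom_one_inv {t : ℂ} (ht : t ≠ 0) : ofHom (1, t) = ((t⁻¹ : ℂ) : P1) := by
  simp [ofHom, ht]

theorem ofHom_eq_infty_iff {v : ℂ × ℂ} : ofHom v = ∞ ↔ v.2 = 0 := by
  by_cases h : v.2 = 0 <;> simp [ofHom, h]

theorem ofHom_eq_coe_iff {v : ℂ × ℂ} {x : ℂ} :
    ofHom v = (x : P1) ↔ v.2 ≠ 0 ∧ v.1 / v.2 = x := by
  by_cases h : v.2 = 0 <;> simp [ofHom, h]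

theorem exists_eq_smul_hom_ofHom {v : ℂ × ℂ} (hv : v ≠ 0) :
    ∃ s : ℂ, s ≠ 0 ∧ v = s • hom (ofHom v) := by
  by_cases h : v.2 = 0
  · exact ⟨v.1, fun fst_eq_zero => hv (Prod.ext fst_eq_zero h), by ext <;> simp [ofHom, h]⟩
  · exact ⟨v.2, h, by ext <;> simp [ofHom, h, mul_div_cancel₀]⟩

theorem br_eq_zero_iff {z w : P1} : br z w = 0 ↔ z = w := by
  induction z using OnePoint.rec <;> induction w using OnePoint.rec <;>
    simp [br, sub_eq_zero]

/-- The automorphism `[x : y] ↦ [y : x]` of the Riemann sphere, which exchanges the two standard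
coordinates. -/
def inversion (z : P1) : P1 := ofHom ((hom z).2, (hom z).1)

theorem inversion_involutive : Function.Involutive inversion := by
  intro z
  induction z using OnePoint.rec with
  | infty => simp [inversion, ofHom]
  | coe t => by_cases ht : t = 0 <;> simp [inversion, ofHom, ht]

theorem tendsto_ofHom_one_nhds_zero : Tendsto (fun t : ℂ => ofHom (1, t)) (𝓝 0) (𝓝 ∞) := by
  have coe_tendsto : Tendsto ((↑) : ℂ → P1) (Bornology.cobounded ℂ) (𝓝 ∞) := by
    rw [Metric.cobounded_eq_cocompact, ← Filter.coclosedCompact_eq_cocompact]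
    exact OnePoint.tendsto_coe_infty
  have tendsto_nhdsNE : Tendsto (fun t : ℂ => ofHom (1, t)) (𝓝[≠] 0) (𝓝 ∞) := by
    refine (coe_tendsto.comp tendsto_inv₀_nhdsNE_zero).congr' ?_
    filter_upwards [self_mem_nhdsWithin] with t ht using (ofHom_one_inv ht).symm
  have ofHom_one_zero : ofHom (1, 0) = ∞ := if_pos rfl
  rw [← ofHom_one_zero] at tendsto_nhdsNE ⊢
  exact continuousAt_iff_punctured_nhds.2 tendsto_nhdsNE

theorem continuous_inversion : Continuous inversion := by
  refine (OnePoint.continuous_iff _).2 ⟨?_, continuous_iff_continuousAt.2 fun t => ?_⟩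
  · have inversion_infty : inversion ∞ = ((0 : ℂ) : P1) := ofHom_coe_one 0
    rw [Filter.coclosedCompact_eq_cocompact, ← Metric.cobounded_eq_cocompact, inversion_infty]
    refine (OnePoint.continuous_coe.continuousAt.tendsto.comp tendsto_inv₀_cobounded).congr' ?_
    filter_upwards [Bornology.eventually_ne_cobounded 0] with t ht using (ofHom_one_inv ht).symm
  · obtain rfl | ht := eq_or_ne t 0
    · have inversion_zero : inversion ((0 : ℂ) : P1) = ∞ := if_pos rfl
      rw [ContinuousAt, inversion_zero]
      exact tendsto_ofHom_one_nhds_zero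
    · refine (OnePoint.continuous_coe.continuousAt.comp (continuousAt_inv₀ ht)).congr ?_
      filter_upwards [isOpen_ne.mem_nhds ht] with x hx using (ofHom_one_inv hx).symm

theorem isOpenEmbedding_chart1Inv (c : P1) : IsOpenEmbedding (chart1Inv c) := by
  induction c using OnePoint.rec with
  | infty =>
    let inversionHomeomorph : P1 ≃ₜ P1 :=
      { inversion_involutive.toPerm with
        continuous_toFun := continuous_inversion
        continuous_invFun := continuous_inversion }
    exact inversionHomeomorph.isOpenEmbedding.comp OnePoint.isOpenEmbedding_coe
  | coe x =>
    have chart1Inv_coe : chart1Inv (x : P1) = ((↑) : ℂ → P1) := funext ofHom_coe_one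
    rw [chart1Inv_coe]
    exact OnePoint.isOpenEmbedding_coe

theorem isOpenEmbedding_chartInv {n : ℕ} (c : Fin n → P1) : IsOpenEmbedding (chartInv c) :=
  IsOpenEmbedding.piMap fun i => isOpenEmbedding_chart1Inv (c i)

end ProjectiveLine

section Permutations

variable {n : ℕ} (α : Fin n → ℂ) (z : Fin n → P1) (σ : Equiv.Perm (Fin n))

theorem stepPair_comp_perm (i : Fin n) : stepPair α (z ∘ σ) i = stepPair α z (σ i) := by
  have erase_map (i j : Fin n) (s : Finset (Fin n)) (hj : j = σ i) :
      (s.map σ.toEmbedding).erase j = (s.erase i).map σ.toEmbedding := by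
    rw [Finset.map_erase, hj, Equiv.coe_toEmbedding]
  have univ_erase : Finset.univ.erase (σ i) = (Finset.univ.erase i).map σ.toEmbedding := by
    rw [← erase_map i _ _ rfl, Finset.map_univ_equiv]
  simp only [stepPair, univ_erase, Finset.sum_map, Finset.prod_map, Equiv.coe_toEmbedding,
    erase_map _ _ _ rfl, Function.comp_apply]

theorem JEA_comp_perm : JEA α (z ∘ σ) = JEA α z ∘ σ :=
  funext fun i => congrArg ofHom (stepPair_comp_perm α z σ i)

variable {α z} in
theorem Defined.comp_perm (h : Defined α z) : Defined α (z ∘ σ) := fun i =>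
  stepPair_comp_perm α z σ i ▸ h (σ i)

end Permutations

section CollisionFree

variable {n : ℕ}

/-- The bracket of two vectors of homogeneous coordinates. -/
def bracket (v w : ℂ × ℂ) : ℂ := v.1 * w.2 - v.2 * w.1

/-- Homogeneous coordinates of the new `i`-th point: this is `stepPair`, for arbitrary homogeneous
coordinates `v` of the points, divided by the product of all brackets. -/
def stepVec (α : Fin n → ℂ) (v : Fin n → ℂ × ℂ) (i : Fin n) : ℂ × ℂ :=
  ∑ k, (bracket (v i) (α k, 1))⁻¹ • (α k, 1) -
    ∑ j ∈ Finset.univ.erase i, (bracket (v i) (v j))⁻¹ • v j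

/-- The vectors `v i` are homogeneous coordinates of the points `z i`. -/
def IsHomLift (v : Fin n → ℂ × ℂ) (z : Fin n → P1) : Prop :=
  ∀ i, ∃ s : ℂ, s ≠ 0 ∧ v i = s • hom (z i)

/-- The points `z i` avoid the roots `α k` and each other, so that all brackets in `stepPair` are
nonzero. -/
structure IsCollisionFree (α : Fin n → ℂ) (z : Fin n → P1) : Prop where
  ne_root : ∀ i k, z i ≠ (α k : P1)
  injective : Function.Injective z

variable {α : Fin n → ℂ} {z : Fin n → P1} {v : Fin n → ℂ × ℂ}

theorem isHomLift_hom (z : Fin n → P1) : IsHomLift (fun i => hom (z i)) z :=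
  fun _ => ⟨1, one_ne_zero, (one_smul ℂ _).symm⟩

theorem bracket_smul_left (s : ℂ) (v w : ℂ × ℂ) : bracket (s • v) w = s * bracket v w := by
  simp only [bracket, Prod.smul_fst, Prod.smul_snd, smul_eq_mul]
  ring

theorem bracket_smul_right (s : ℂ) (v w : ℂ × ℂ) : bracket v (s • w) = s * bracket v w := by
  simp only [bracket, Prod.smul_fst, Prod.smul_snd, smul_eq_mul]
  ring

theorem bracket_sub_right (v w w' : ℂ × ℂ) : bracket v (w - w') = bracket v w - bracket v w' := by
  simp only [bracket, Prod.fst_sub, Prod.snd_sub]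
  ring

theorem bracket_sum_right {ι : Type*} (v : ℂ × ℂ) (s : Finset ι) (w : ι → ℂ × ℂ) :
    bracket v (∑ k ∈ s, w k) = ∑ k ∈ s, bracket v (w k) := by
  simp only [bracket, Prod.fst_sum, Prod.snd_sum, Finset.mul_sum, Finset.sum_sub_distrib]

theorem prod_erase_eq_mul_inv {ι K : Type*} [DecidableEq ι] [Field K] {s : Finset ι} {f : ι → K}
    {k : ι} (hk : k ∈ s) (hf : f k ≠ 0) : ∏ l ∈ s.erase k, f l = (∏ l ∈ s, f l) * (f k)⁻¹ := by
  rw [eq_mul_inv_iff_mul_eq₀ hf, Finset.prod_erase_mul _ _ hk]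

namespace IsCollisionFree

theorem comp_perm (h : IsCollisionFree α z) (σ : Equiv.Perm (Fin n)) :
    IsCollisionFree α (z ∘ σ) :=
  ⟨fun i => h.ne_root (σ i), h.injective.comp σ.injective⟩

theorem bracket_root_ne_zero (h : IsCollisionFree α z) (hv : IsHomLift v z) (i k : Fin n) :
    bracket (v i) (α k, 1) ≠ 0 := by
  obtain ⟨s, hs, hvs⟩ := hv i
  rw [hvs, bracket_smul_left]
  exact mul_ne_zero hs fun br_eq_zero => h.ne_root i k (br_eq_zero_iff.1 br_eq_zero)

theorem bracket_ne_zero (h : IsCollisionFree α z) (hv : IsHomLift v z) {i j : Fin n}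
    (hij : j ∈ Finset.univ.erase i) : bracket (v i) (v j) ≠ 0 := by
  obtain ⟨s, hs, hvs⟩ := hv i
  obtain ⟨r, hr, hvr⟩ := hv j
  rw [hvs, hvr, bracket_smul_left, bracket_smul_right]
  exact mul_ne_zero hs (mul_ne_zero hr
    (mt br_eq_zero_iff.1 (h.injective.ne (Finset.ne_of_mem_erase hij).symm)))

/-- The left side is a sum of `n` terms equal to `1` minus a sum of `n - 1` such terms. -/
theorem bracket_stepVec (h : IsCollisionFree α z) (hv : IsHomLift v z) (i : Fin n) :
    bracket (v i) (stepVec α v i) = 1 := by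
  simp only [stepVec, bracket_sub_right, bracket_sum_right, bracket_smul_right]
  rw [Finset.sum_congr rfl fun k _ => inv_mul_cancel₀ (h.bracket_root_ne_zero hv i k),
    Finset.sum_congr rfl fun j hj => inv_mul_cancel₀ (h.bracket_ne_zero hv hj),
    Finset.sum_const, Finset.sum_const, ← Finset.card_erase_add_one (Finset.mem_univ i),
    add_smul, one_smul, add_sub_cancel_left]

theorem stepVec_ne_zero (h : IsCollisionFree α z) (hv : IsHomLift v z) (i : Fin n) :
    stepVec α v i ≠ 0 := fun hzero => by
  simpa [hzero, bracket] using h.bracket_stepVec hv i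

theorem exists_stepPair_eq_smul (h : IsCollisionFree α z) (i : Fin n) :
    ∃ s : ℂ, s ≠ 0 ∧ stepPair α z i = s • stepVec α (fun j => hom (z j)) i := by
  have br_root_ne_zero (k : Fin n) : br (z i) (α k) ≠ 0 :=
    h.bracket_root_ne_zero (isHomLift_hom z) i k
  have br_ne_zero {j : Fin n} (hj : j ∈ Finset.univ.erase i) : br (z i) (z j) ≠ 0 :=
    h.bracket_ne_zero (isHomLift_hom z) hj
  refine ⟨(∏ l, br (z i) (α l)) * ∏ l ∈ Finset.univ.erase i, br (z i) (z l), mul_ne_zero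
    (Finset.prod_ne_zero_iff.2 fun k _ => br_root_ne_zero k)
    (Finset.prod_ne_zero_iff.2 fun j hj => br_ne_zero hj), ?_⟩
  simp only [stepPair, stepVec, smul_sub, Finset.smul_sum, Prod.ext_iff, Prod.fst_sub,
    Prod.snd_sub, Prod.fst_sum, Prod.snd_sum, Prod.smul_fst, Prod.smul_snd, smul_eq_mul]
  refine ⟨congrArg₂ _ ?_ ?_, congrArg₂ _ ?_ ?_⟩ <;> refine Finset.sum_congr rfl fun k hk => ?_
  · rw [prod_erase_eq_mul_inv hk (br_root_ne_zero k), br, bracket, hom_coe]; ring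
  · rw [prod_erase_eq_mul_inv hk (br_ne_zero hk), br, bracket]; ring
  · rw [prod_erase_eq_mul_inv hk (br_root_ne_zero k), br, bracket, hom_coe]; ring
  · rw [prod_erase_eq_mul_inv hk (br_ne_zero hk), br, bracket]; ring

theorem defined (h : IsCollisionFree α z) : Defined α z := fun i => by
  obtain ⟨s, hs, hstep⟩ := h.exists_stepPair_eq_smul i
  rw [hstep]
  exact smul_ne_zero hs (h.stepVec_ne_zero (isHomLift_hom z) i)

theorem JEA_apply (h : IsCollisionFree α z) (hv : IsHomLift v z) (i : Fin n) :
    JEA α z i = ofHom (stepVec α v i) := by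
  choose s hs hvs using hv
  obtain ⟨r, hr, hstep⟩ := h.exists_stepPair_eq_smul i
  have stepVec_eq_smul : stepVec α (fun j => hom (z j)) i = s i • stepVec α v i := by
    simp only [stepVec, hvs, bracket_smul_left, bracket_smul_right, smul_sub, Finset.smul_sum,
      smul_smul, mul_inv]
    refine congrArg₂ _ (Finset.sum_congr rfl fun k _ => ?_) (Finset.sum_congr rfl fun j _ => ?_)
    · rw [mul_inv_cancel_left₀ (hs i)]
    · rw [mul_right_comm, inv_mul_cancel₀ (hs j), one_mul, mul_inv_cancel_left₀ (hs i)]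
  rw [JEA, hstep, ofHom_smul hr, stepVec_eq_smul, ofHom_smul (hs i)]

theorem JEA_apply_of_coe (h : IsCollisionFree α z) {i : Fin n} {t : ℂ} (hi : z i = t)
    (hne : (stepVec α (fun j => hom (z j)) i).2 ≠ 0) :
    JEA α z i = ((t - 1 / (stepVec α (fun j => hom (z j)) i).2 : ℂ) : P1) := by
  have bracket_eq_one := h.bracket_stepVec (isHomLift_hom z) i
  simp only [hi, hom_coe, bracket, one_mul] at bracket_eq_one
  rw [h.JEA_apply (isHomLift_hom z), ofHom_eq_coe_iff]
  refine ⟨hne, ?_⟩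
  field_simp
  linear_combination -bracket_eq_one

end IsCollisionFree

theorem differentiableAt_prod_sub (s : Finset (Fin n)) (a : Fin n → ℂ) (t : ℂ) :
    DifferentiableAt ℂ (fun x => ∏ k ∈ s, (x - a k)) t :=
  (hasDerivAt_prod_sub s a t).differentiableAt

theorem logDeriv_prod_sub {s : Finset (Fin n)} {a : Fin n → ℂ} {t : ℂ}
    (ht : ∀ k ∈ s, t - a k ≠ 0) :
    logDeriv (fun x => ∏ k ∈ s, (x - a k)) t = ∑ k ∈ s, 1 / (t - a k) := by
  rw [logDeriv_prod ht fun k _ => differentiableAt_fun_id.sub_const (a k)]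
  simp [logDeriv_apply]

variable {x x' : Fin n → ℂ}

theorem q_rootPoly (α x : Fin n → ℂ) (i : Fin n) : q (rootPoly α) x i =
    fun t => (∏ k, (t - α k)) / ∏ j ∈ Finset.univ.erase i, (t - x j) := by
  funext t
  simp [q, rootPoly, eval_prod]

namespace IsCollisionFree

theorem sub_root_ne_zero (h : IsCollisionFree α (incl x)) (i k : Fin n) : x i - α k ≠ 0 := by
  simpa [bracket, incl] using h.bracket_root_ne_zero (isHomLift_hom _) i k

theorem sub_point_ne_zero (h : IsCollisionFree α (incl x)) {i j : Fin n}
    (hj : j ∈ Finset.univ.erase i) : x i - x j ≠ 0 := by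
  simpa [bracket, incl] using h.bracket_ne_zero (isHomLift_hom _) hj

theorem q_ne_zero (h : IsCollisionFree α (incl x)) (i : Fin n) :
    q (rootPoly α) x i (x i) ≠ 0 := by
  rw [q_rootPoly]
  exact div_ne_zero (Finset.prod_ne_zero_iff.2 fun k _ => h.sub_root_ne_zero i k)
    (Finset.prod_ne_zero_iff.2 fun j hj => h.sub_point_ne_zero hj)

theorem logDeriv_q (h : IsCollisionFree α (incl x)) (i : Fin n) :
    logDeriv (q (rootPoly α) x i) (x i) = (stepVec α (fun j => (x j, 1)) i).2 := by
  rw [q_rootPoly, logDeriv_div (x i)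
    (Finset.prod_ne_zero_iff.2 fun k _ => h.sub_root_ne_zero i k)
    (Finset.prod_ne_zero_iff.2 fun j hj => h.sub_point_ne_zero hj)
    (differentiableAt_prod_sub _ _ _) (differentiableAt_prod_sub _ _ _),
    logDeriv_prod_sub fun k _ => h.sub_root_ne_zero i k,
    logDeriv_prod_sub fun j hj => h.sub_point_ne_zero hj]
  simp [stepVec, bracket, Prod.snd_sum]

theorem isAffineStep (h : IsCollisionFree α (incl x)) (hJEA : JEA α (incl x) = incl x') :
    IsAffineStep (rootPoly α) x x' := fun i => by
  have q_ne_zero := h.q_ne_zero i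
  have deriv_q : deriv (q (rootPoly α) x i) (x i)
      = (stepVec α (fun j => (x j, 1)) i).2 * q (rootPoly α) x i (x i) := by
    rw [← h.logDeriv_q, logDeriv_apply, div_mul_cancel₀ _ q_ne_zero]
  have den_ne_zero : (stepVec α (fun j => (x j, 1)) i).2 ≠ 0 :=
    (ofHom_eq_coe_iff.1
      ((h.JEA_apply (isHomLift_hom (incl x)) i).symm.trans (congrFun hJEA i))).1
  have step_eq : x' i = x i - 1 / (stepVec α (fun j => (x j, 1)) i).2 :=
    OnePoint.coe_injective ((congrFun hJEA i).symm.trans (h.JEA_apply_of_coe rfl den_ne_zero))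
  refine ⟨fun j hj => sub_ne_zero.1 (h.sub_point_ne_zero (by simp [hj])), ?_, ?_⟩
  · exact deriv_q ▸ mul_ne_zero den_ne_zero q_ne_zero
  · rw [step_eq, deriv_q, div_mul_cancel_right₀ q_ne_zero, one_div]

end IsCollisionFree

end CollisionFree

section TwistedLocalForm

variable {n : ℕ}

/-- On the coordinate patch `N` near `c`, which stays away from collisions, the Jacobi
Ehrlich–Aberth map is `G` followed by the permutation `σ` of the coordinates, where `σ² = 1`. If `G`
fixes `c`, then `c` has period two under the Jacobi Ehrlich–Aberth map. -/
structure IsTwistedLocalForm (α : Fin n → ℂ) (c : Fin n → P1) (σ : Equiv.Perm (Fin n))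
    (G : (Fin n → ℂ) → Fin n → ℂ) (N : Set (Fin n → ℂ)) : Prop where
  sq_eq_one : σ ^ 2 = 1
  isCollisionFree : ∀ t ∈ N, IsCollisionFree α (chartInv c t)
  JEA_eq : ∀ t ∈ N, JEA α (chartInv c t) = chartInv c (G t) ∘ σ

/-- The point of `ℂⁿ` whose coordinates near `c` are `t`, provided that `t i ≠ 0` whenever
`c i = ∞`. -/
def affinePt (c : Fin n → P1) (t : Fin n → ℂ) : Fin n → ℂ :=
  fun i => (c i).elim (t i)⁻¹ fun _ => t i

theorem incl_affinePt {c : Fin n → P1} {t : Fin n → ℂ} (ht : ∀ i, c i = ∞ → t i ≠ 0) :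
    incl (affinePt c t) = chartInv c t := by
  funext i
  specialize ht i
  simp only [incl, affinePt, chartInv, chart1Inv]
  generalize c i = x at ht
  induction x using OnePoint.rec with
  | infty => exact (ofHom_one_inv (ht rfl)).symm
  | coe x => exact (ofHom_coe_one (t i)).symm

theorem exists_eq_infty_of_notMem_finitePart {c : Fin n → P1} (hc : c ∉ finitePart n) :
    ∃ i, c i = ∞ := by
  by_contra! hne
  choose z hz using fun i => OnePoint.ne_infty_iff_exists.1 (hne i)
  exact hc ⟨z, funext hz⟩

theorem tendsto_norm_affinePt_comp {c : Fin n → P1} {t : ℕ → Fin n → ℂ}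
    (σ : ℕ → Equiv.Perm (Fin n)) (hc : c ∉ finitePart n)
    (hne : ∀ k i, c i = ∞ → t k i ≠ 0) (ht : Tendsto t atTop (𝓝 (chart c c))) :
    Tendsto (fun k => ‖affinePt c (t k) ∘ σ k‖) atTop atTop := by
  obtain ⟨i, hi⟩ := exists_eq_infty_of_notMem_finitePart hc
  have coord_tendsto : Tendsto (fun k => t k i) atTop (𝓝[≠] 0) := by
    have chart_eq_zero : chart c c i = 0 := by simp [chart, chart1, hi]
    exact tendsto_nhdsWithin_iff.2
      ⟨chart_eq_zero ▸ tendsto_pi_nhds.1 ht i, Eventually.of_forall fun k => hne k i hi⟩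
  refine tendsto_atTop_mono (fun k => ?_)
    (tendsto_norm_inv_nhdsNE_zero_atTop.comp coord_tendsto)
  have norm_le := norm_le_pi_norm (affinePt c (t k) ∘ σ k) ((σ k).symm i)
  simpa only [affinePt, Function.comp_apply, Equiv.apply_symm_apply, hi, OnePoint.elim_infty]
    using norm_le

theorem IsOrbit.isAffineOrbit {α : Fin n → ℂ} {Z : ℕ → Fin n → ℂ}
    (hZ : IsOrbit α fun k => incl (Z k)) (hfree : ∀ k, IsCollisionFree α (incl (Z k))) :
    IsAffineOrbit (rootPoly α) Z :=
  fun k => (hfree k).isAffineStep (hZ k).2.symm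

namespace IsTwistedLocalForm

variable {α : Fin n → ℂ} {c : Fin n → P1} {σ : Equiv.Perm (Fin n)} {G : (Fin n → ℂ) → Fin n → ℂ}
  {N : Set (Fin n → ℂ)}

theorem mono (H : IsTwistedLocalForm α c σ G N) {N' : Set (Fin n → ℂ)} (hN : N' ⊆ N) :
    IsTwistedLocalForm α c σ G N' :=
  ⟨H.sq_eq_one, fun t ht => H.isCollisionFree t (hN ht), fun t ht => H.JEA_eq t (hN ht)⟩

theorem isOrbit (H : IsTwistedLocalForm α c σ G N) {t : Fin n → ℂ} (ht : ∀ k, G^[k] t ∈ N) :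
    IsOrbit α fun k => chartInv c (G^[k] t) ∘ (σ ^ k : Equiv.Perm (Fin n)) := by
  refine fun k => ⟨(H.isCollisionFree _ (ht k)).defined.comp_perm _, ?_⟩
  simp only [JEA_comp_perm, H.JEA_eq _ (ht k), Function.iterate_succ_apply', pow_succ',
    Equiv.Perm.coe_mul, Function.comp_assoc]

theorem chartInv_comp_pow_two_mul (H : IsTwistedLocalForm α c σ G N) (t : Fin n → ℂ) (k : ℕ) :
    chartInv c t ∘ (σ ^ (2 * k) : Equiv.Perm (Fin n)) = chartInv c t := by
  rw [pow_mul, H.sq_eq_one, one_pow, Equiv.Perm.coe_one, Function.comp_id]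

theorem JEA_JEA (H : IsTwistedLocalForm α c σ G N) {t : Fin n → ℂ} (ht : t ∈ N) (hG : G t ∈ N) :
    JEA α (JEA α (chartInv c t)) = chartInv c (G (G t)) := by
  rw [H.JEA_eq t ht, JEA_comp_perm, H.JEA_eq _ hG, Function.comp_assoc, ← Equiv.Perm.coe_mul,
    ← sq, H.sq_eq_one, Equiv.Perm.coe_one, Function.comp_id]

theorem hasFDerivAt_localReturn (H : IsTwistedLocalForm α c σ G N) {b : Fin n → ℂ} (hN : N ∈ 𝓝 b)
    (hb : G b = b) {M : (Fin n → ℂ) →L[ℂ] (Fin n → ℂ)} (hG : HasFDerivAt G M b) :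
    HasFDerivAt (localReturn α c) (M.comp M) b := by
  have hGG : HasFDerivAt (G ∘ G) (M.comp M) b := HasFDerivAt.comp b (hb.symm ▸ hG) hG
  refine hGG.congr_of_eventuallyEq ?_
  filter_upwards [hN, hG.continuousAt.preimage_mem_nhds (hb.symm ▸ hN)] with t ht hGt
  rw [localReturn, H.JEA_JEA ht hGt, chart_chartInv, Function.comp_apply]

theorem image_eq_localStableSet (H : IsTwistedLocalForm α c σ G N) {γ : ℂ → Fin n → ℂ}
    (D : IsStableDisc G (chart c c) N γ) :
    (fun s => chartInv c (γ s)) '' Metric.ball 0 1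
      = localStableSet α c (chartInv c '' (N ∩ G ⁻¹' N)) := by
  refine Set.Subset.antisymm ?_ ?_
  · rintro _ ⟨s, hs, rfl⟩
    have mem_N : ∀ k, G^[k] (γ s) ∈ N := by
      have := Set.mem_image_of_mem γ hs
      rwa [D.image_eq] at this
    refine ⟨_, H.isOrbit mem_N, rfl, fun k => ?_, ?_⟩
    · rw [H.chartInv_comp_pow_two_mul]
      refine Set.mem_image_of_mem _ ⟨mem_N (2 * k), ?_⟩
      simpa only [Set.mem_preimage, Function.iterate_succ_apply'] using mem_N (2 * k + 1)
    · simp only [H.chartInv_comp_pow_two_mul]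
      have chartInv_tendsto : Tendsto (chartInv c) (𝓝 (chart c c)) (𝓝 c) := by
        simpa only [chartInv_chart_self] using
          (isOpenEmbedding_chartInv c).continuous.tendsto (chart c c)
      exact chartInv_tendsto.comp ((D.tendsto s hs).comp
        (tendsto_id.const_mul_atTop' two_pos))
  · rintro _ ⟨x, hx, rfl, hxN, -⟩
    obtain ⟨t, ht, htx⟩ := hxN 0
    have even_iterate (k : ℕ) : x (2 * k) = chartInv c (G^[2 * k] t) ∧
        G^[2 * k] t ∈ N ∧ G^[2 * k + 1] t ∈ N := by
      induction k with
      | zero => exact ⟨htx.symm, ht⟩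
      | succ k ih =>
        obtain ⟨x_eq, mem_even, mem_odd⟩ := ih
        rw [Function.iterate_succ_apply'] at mem_odd
        have x_succ : x (2 * (k + 1)) = chartInv c (G^[2 * (k + 1)] t) := by
          rw [mul_add_one, (hx _).2, (hx _).2, x_eq, H.JEA_JEA mem_even mem_odd]
          simp only [Function.iterate_succ_apply']
        obtain ⟨t', ht', ht'x⟩ := hxN (k + 1)
        obtain rfl := (isOpenEmbedding_chartInv c).injective (ht'x.trans x_succ)
        exact ⟨x_succ, ht'.1, by rw [Function.iterate_succ_apply']; exact ht'.2⟩
    have mem_N : t ∈ γ '' Metric.ball 0 1 := by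
      rw [D.image_eq]
      intro k
      obtain ⟨j, rfl | rfl⟩ := Nat.even_or_odd' k
      exacts [(even_iterate j).2.1, (even_iterate j).2.2]
    obtain ⟨s, hs, rfl⟩ := mem_N
    exact ⟨s, hs, htx⟩

theorem isLocalStableDisc (H : IsTwistedLocalForm α c σ G N) {γ : ℂ → Fin n → ℂ}
    (D : IsStableDisc G (chart c c) N γ) (hb : G (chart c c) = chart c c) (hG : ContinuousOn G N)
    {L : (Fin n → ℂ) →L[ℂ] (Fin n → ℂ)} {μ : ℂ} (hμ : ‖μ‖ < 1)
    (hL : L (deriv γ 0) = μ • deriv γ 0) : IsLocalStableDisc α c L γ := by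
  have center_mem : chart c c ∈ N := by
    have : γ 0 ∈ γ '' Metric.ball 0 1 := Set.mem_image_of_mem γ (Metric.mem_ball_self one_pos)
    rw [D.image_eq, D.map_zero] at this
    exact this 0
  refine ⟨⟨D.differentiableOn, D.deriv_ne_zero, D.isEmbedding⟩, D.map_zero,
    ⟨_, (isOpenEmbedding_chartInv c).isOpenMap _ (hG.isOpen_inter_preimage D.isOpen D.isOpen),
      ⟨chart c c, ⟨center_mem, ?_⟩, chartInv_chart_self c⟩, H.image_eq_localStableSet D⟩, μ, hμ, hL⟩
  rwa [Set.mem_preimage, hb]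

theorem exists_divergent_isAffineOrbit (H : IsTwistedLocalForm α c σ G N) (hc : c ∉ finitePart n)
    {t : Fin n → ℂ} (ht : ∀ k, G^[k] t ∈ N) (hne : ∀ k i, c i = ∞ → G^[k] t i ≠ 0)
    (hlim : Tendsto (fun k => G^[k] t) atTop (𝓝 (chart c c))) :
    ∃ Z : ℕ → Fin n → ℂ, incl (Z 0) = chartInv c t ∧ IsAffineOrbit (rootPoly α) Z ∧
      Tendsto (fun k => ‖Z k‖) atTop atTop := by
  have incl_eq (k : ℕ) : incl (affinePt c (G^[k] t) ∘ (σ ^ k : Equiv.Perm (Fin n)))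
      = chartInv c (G^[k] t) ∘ (σ ^ k : Equiv.Perm (Fin n)) :=
    congrArg (· ∘ (σ ^ k : Equiv.Perm (Fin n))) (incl_affinePt (hne k))
  refine ⟨_, incl_eq 0, IsOrbit.isAffineOrbit ?_ fun k => ?_,
    tendsto_norm_affinePt_comp (fun k => σ ^ k) hc hne hlim⟩
  · simpa only [incl_eq] using H.isOrbit ht
  · exact incl_eq k ▸ (H.isCollisionFree _ (ht k)).comp_perm _

end IsTwistedLocalForm

end TwistedLocalForm

section Coordinates

variable {n : ℕ}

/-- Homogeneous coordinates of `chart1Inv c t` that depend holomorphically on `t`. -/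
def chartLift1 (c : P1) (t : ℂ) : ℂ × ℂ := c.elim (1, t) fun _ => (t, 1)

/-- Homogeneous coordinates of `chartInv c t` that depend holomorphically on `t`. -/
def chartLift (c : Fin n → P1) (t : Fin n → ℂ) : Fin n → ℂ × ℂ := fun i => chartLift1 (c i) (t i)

/-- The homogeneous coordinate that is the denominator of `chart1 c`. -/
def chartDen (c : P1) (v : ℂ × ℂ) : ℂ := c.elim v.1 fun _ => v.2

theorem chart1Inv_eq_ofHom (c : P1) (t : ℂ) : chart1Inv c t = ofHom (chartLift1 c t) := by
  induction c using OnePoint.rec <;> rfl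

theorem chartLift1_ne_zero (c : P1) (t : ℂ) : chartLift1 c t ≠ 0 := by
  induction c using OnePoint.rec <;> simp [chartLift1]

theorem isHomLift_chartLift (c : Fin n → P1) (t : Fin n → ℂ) :
    IsHomLift (chartLift c t) (chartInv c t) := fun i => by
  rw [chartInv, chart1Inv_eq_ofHom]
  exact exists_eq_smul_hom_ofHom (chartLift1_ne_zero _ _)

theorem isHomLift_chartLift_chart (c : Fin n → P1) : IsHomLift (chartLift c (chart c c)) c := by
  simpa only [chartInv_chart_self] using isHomLift_chartLift c (chart c c)

theorem chartLift_chart (c : Fin n → P1) : chartLift c (chart c c) = fun i => hom (c i) := by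
  funext i
  simp only [chartLift, chartLift1, chart, chart1]
  induction c i using OnePoint.rec <;> simp

theorem chart1_ofHom (c : P1) (v : ℂ × ℂ) :
    chart1 c (ofHom v) = c.elim (v.2 / v.1) fun _ => v.1 / v.2 := by
  by_cases h : v.2 = 0 <;> induction c using OnePoint.rec <;> simp [chart1, ofHom, h]

theorem chart1Inv_chart1_ofHom {c : P1} {v : ℂ × ℂ} (hv : chartDen c v ≠ 0) :
    chart1Inv c (chart1 c (ofHom v)) = ofHom v := by
  rw [chart1Inv_eq_ofHom, chart1_ofHom, ← ofHom_smul hv]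
  induction c using OnePoint.rec <;>
    exact congrArg ofHom (Prod.ext (by simp_all [chartLift1, chartDen, mul_div_cancel₀])
      (by simp_all [chartLift1, chartDen, mul_div_cancel₀]))

theorem chartDen_ne_zero {c : P1} {v : ℂ × ℂ} (hv : v ≠ 0) (hc : ofHom v = c) :
    chartDen c v ≠ 0 := by
  subst hc
  by_cases h : v.2 = 0
  · have fst_ne_zero : v.1 ≠ 0 := fun fst_eq_zero => hv (Prod.ext fst_eq_zero h)
    simpa [chartDen, ofHom, h] using fst_ne_zero
  · simp [chartDen, ofHom, h]

theorem contDiff_chartLift1 (c : P1) : ContDiff ℂ 1 (chartLift1 c) := by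
  induction c using OnePoint.rec
  · exact contDiff_const.prodMk contDiff_id
  · exact contDiff_id.prodMk contDiff_const

theorem contDiff_chartLift (c : Fin n → P1) : ContDiff ℂ 1 (chartLift c) :=
  contDiff_pi.2 fun i => (contDiff_chartLift1 (c i)).comp (contDiff_apply ℂ ℂ i)

theorem contDiff_chartDen (c : P1) : ContDiff ℂ 1 (chartDen c) := by
  induction c using OnePoint.rec
  · exact contDiff_fst
  · exact contDiff_snd

theorem contDiffAt_chart1_ofHom {c : P1} {v : ℂ × ℂ} (hv : chartDen c v ≠ 0) :
    ContDiffAt ℂ 1 (fun v => chart1 c (ofHom v)) v := by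
  simp only [chart1_ofHom]
  induction c using OnePoint.rec
  · exact contDiffAt_snd.div contDiffAt_fst hv
  · exact contDiffAt_fst.div contDiffAt_snd hv

end Coordinates

section LocalMap

variable {n : ℕ} {α : Fin n → ℂ} {c : Fin n → P1} {σ : Equiv.Perm (Fin n)}

theorem isOpen_isCollisionFree (α : Fin n → ℂ) : IsOpen {z | IsCollisionFree α z} := by
  have isOpen_ne_root : IsOpen (⋂ i, ⋂ k, {z : Fin n → P1 | z i ≠ (α k : P1)}) :=
    isOpen_iInter_of_finite fun i => isOpen_iInter_of_finite fun k =>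
      isOpen_ne_fun (continuous_apply i) continuous_const
  have isOpen_ne_point : IsOpen (⋂ p : {p : Fin n × Fin n // p.1 ≠ p.2},
      {z : Fin n → P1 | z p.1.1 ≠ z p.1.2}) :=
    isOpen_iInter_of_finite fun p => isOpen_ne_fun (continuous_apply _) (continuous_apply _)
  convert isOpen_ne_root.inter isOpen_ne_point using 1
  ext z
  simp only [Set.mem_ofPred_eq, Set.mem_inter_iff, Set.mem_iInter, Subtype.forall, Prod.forall]
  exact ⟨fun h => ⟨h.ne_root, fun i j => h.injective.ne⟩,
    fun h => ⟨h.1, fun i j => not_imp_not.1 (h.2 i j)⟩⟩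

theorem contDiffAt_bracket {E : Type*} [NormedAddCommGroup E] [NormedSpace ℂ E]
    {v w : E → ℂ × ℂ} {x : E} (hv : ContDiffAt ℂ 1 v x) (hw : ContDiffAt ℂ 1 w x) :
    ContDiffAt ℂ 1 (fun x => bracket (v x) (w x)) x :=
  (hv.fst.mul hw.snd).sub (hv.snd.mul hw.fst)

theorem IsCollisionFree.contDiffAt_stepVec {z : Fin n → P1} {v : Fin n → ℂ × ℂ}
    (h : IsCollisionFree α z) (hv : IsHomLift v z) (i : Fin n) :
    ContDiffAt ℂ 1 (fun v => stepVec α v i) v := by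
  have bracket_inv {w : (Fin n → ℂ × ℂ) → ℂ × ℂ} (hw : ContDiffAt ℂ 1 w v)
      (hne : bracket (v i) (w v) ≠ 0) :
      ContDiffAt ℂ 1 (fun v => (bracket (v i) (w v))⁻¹) v :=
    (contDiffAt_bracket (contDiffAt_apply _ _ i v) hw).inv hne
  have root_term (k : Fin n) :
      ContDiffAt ℂ 1 (fun v => (bracket (v i) (α k, 1))⁻¹ • (α k, (1 : ℂ))) v :=
    (bracket_inv contDiffAt_const (h.bracket_root_ne_zero hv i k)).smul contDiffAt_const
  have point_term {j : Fin n} (hj : j ∈ Finset.univ.erase i) :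
      ContDiffAt ℂ 1 (fun v => (bracket (v i) (v j))⁻¹ • v j) v :=
    (bracket_inv (contDiffAt_apply _ _ j v) (h.bracket_ne_zero hv hj)).smul
      (contDiffAt_apply _ _ j v)
  exact (ContDiffAt.sum fun k _ => root_term k).sub (ContDiffAt.sum fun j hj => point_term hj)

/-- The Jacobi Ehrlich–Aberth map, followed by the permutation `σ` of the points, in the coordinates
near `c`. -/
def localMap (α : Fin n → ℂ) (c : Fin n → P1) (σ : Equiv.Perm (Fin n)) (t : Fin n → ℂ) :
    Fin n → ℂ :=
  chart c (JEA α (chartInv c t) ∘ σ)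

/-- The Jacobi Ehrlich–Aberth map permutes the coordinates of the collision-free point `c` by `σ`,
where `σ² = 1`. -/
structure IsTwistedFixedPoint (α : Fin n → ℂ) (c : Fin n → P1) (σ : Equiv.Perm (Fin n)) :
    Prop where
  sq_eq_one : σ ^ 2 = 1
  isCollisionFree : IsCollisionFree α c
  JEA_eq : JEA α c = c ∘ σ

namespace IsTwistedFixedPoint

theorem JEA_comp (H : IsTwistedFixedPoint α c σ) : JEA α c ∘ σ = c := by
  rw [H.JEA_eq, Function.comp_assoc, ← Equiv.Perm.coe_mul, ← sq, H.sq_eq_one,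
    Equiv.Perm.coe_one, Function.comp_id]

theorem isTwoCycle (H : IsTwistedFixedPoint α c σ) (hσ : σ ≠ 1) : IsTwoCycle α c (c ∘ σ) :=
  ⟨H.isCollisionFree.defined, H.isCollisionFree.defined.comp_perm σ, H.JEA_eq,
    (JEA_comp_perm α c σ).trans H.JEA_comp,
    fun hc => hσ (Equiv.ext fun i => (H.isCollisionFree.injective (congrFun hc i)).symm)⟩

theorem localMap_chart (H : IsTwistedFixedPoint α c σ) :
    localMap α c σ (chart c c) = chart c c := by
  rw [localMap, chartInv_chart_self, H.JEA_comp]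

theorem eventually_isCollisionFree (H : IsTwistedFixedPoint α c σ) :
    ∀ᶠ t in 𝓝 (chart c c), IsCollisionFree α (chartInv c t) := by
  refine (isOpenEmbedding_chartInv c).continuous.continuousAt.eventually
    ((isOpen_isCollisionFree α).mem_nhds ?_)
  rw [chartInv_chart_self]
  exact H.isCollisionFree

theorem ofHom_stepVec (H : IsTwistedFixedPoint α c σ) (i : Fin n) :
    ofHom (stepVec α (fun j => hom (c j)) (σ i)) = c i := by
  rw [← H.isCollisionFree.JEA_apply (isHomLift_hom c)]
  exact congrFun H.JEA_comp i

theorem chartDen_stepVec_ne_zero (H : IsTwistedFixedPoint α c σ) (i : Fin n) :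
    chartDen (c i) (stepVec α (chartLift c (chart c c)) (σ i)) ≠ 0 := by
  rw [chartLift_chart]
  exact chartDen_ne_zero (H.isCollisionFree.stepVec_ne_zero (isHomLift_hom c) _)
    (H.ofHom_stepVec i)

theorem contDiffAt_stepVec_chartLift (H : IsTwistedFixedPoint α c σ) (i : Fin n) :
    ContDiffAt ℂ 1 (fun t => stepVec α (chartLift c t) i) (chart c c) :=
  (H.isCollisionFree.contDiffAt_stepVec (isHomLift_chartLift_chart c) i).comp _
    (contDiff_chartLift c).contDiffAt

theorem localMap_eventuallyEq (H : IsTwistedFixedPoint α c σ) : localMap α c σ =ᶠ[𝓝 (chart c c)]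
    fun t i => chart1 (c i) (ofHom (stepVec α (chartLift c t) (σ i))) := by
  filter_upwards [H.eventually_isCollisionFree] with t ht
  exact funext fun i => congrArg (chart1 (c i)) (ht.JEA_apply (isHomLift_chartLift c t) (σ i))

theorem contDiffAt_localMap (H : IsTwistedFixedPoint α c σ) :
    ContDiffAt ℂ 1 (localMap α c σ) (chart c c) := by
  refine (contDiffAt_pi.2 fun i => ?_).congr_of_eventuallyEq H.localMap_eventuallyEq
  exact (contDiffAt_chart1_ofHom (H.chartDen_stepVec_ne_zero i)).comp
    (f := fun t => stepVec α (chartLift c t) (σ i)) _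
    (H.contDiffAt_stepVec_chartLift (σ i))

theorem exists_isTwistedLocalForm (H : IsTwistedFixedPoint α c σ) : ∃ N ∈ 𝓝 (chart c c),
    IsTwistedLocalForm α c σ (localMap α c σ) N ∧ ContinuousOn (localMap α c σ) N := by
  have chartDen_eventually_ne : ∀ᶠ t in 𝓝 (chart c c), ∀ i,
      chartDen (c i) (stepVec α (chartLift c t) (σ i)) ≠ 0 :=
    eventually_all.2 fun i => ((contDiff_chartDen (c i)).continuous.continuousAt.comp
      (H.contDiffAt_stepVec_chartLift (σ i)).continuousAt).eventually_ne
        (H.chartDen_stepVec_ne_zero i)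
  have eventually_contDiffAt := H.contDiffAt_localMap.eventually (by simp)
  refine ⟨_, H.eventually_isCollisionFree.and
      (chartDen_eventually_ne.and eventually_contDiffAt),
    ⟨H.sq_eq_one, fun t ht => ht.1, fun t ⟨free, den_ne_zero, _⟩ => ?_⟩,
    fun t ht => ht.2.2.continuousAt.continuousWithinAt⟩
  have chartInv_localMap : chartInv c (localMap α c σ t) = JEA α (chartInv c t) ∘ σ :=
    funext fun i => by
      simp only [chartInv, localMap, chart, Function.comp_apply,
        free.JEA_apply (isHomLift_chartLift c t), chart1Inv_chart1_ofHom (den_ne_zero i)]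
  rw [chartInv_localMap, Function.comp_assoc, ← Equiv.Perm.coe_mul, ← sq, H.sq_eq_one,
    Equiv.Perm.coe_one, Function.comp_id]

end IsTwistedFixedPoint

end LocalMap

section Derivative

variable {n : ℕ} {α : Fin n → ℂ} {c : Fin n → P1} {σ : Equiv.Perm (Fin n)}

/-- The derivative of `chartLift c` in the direction `h`. -/
def chartLiftDeriv (c : Fin n → P1) (h : Fin n → ℂ) : Fin n → ℂ × ℂ :=
  fun i => (c i).elim (0, h i) fun _ => (h i, 0)

/-- The derivative at `v`, in the direction `w`, of the `i`-th component of `stepVec`. -/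
def stepVecDeriv (α : Fin n → ℂ) (v w : Fin n → ℂ × ℂ) (i : Fin n) : ℂ × ℂ :=
  ∑ k, -(bracket (w i) (α k, 1) / bracket (v i) (α k, 1) ^ 2) • (α k, 1) -
    ∑ j ∈ Finset.univ.erase i, ((bracket (v i) (v j))⁻¹ • w j -
      ((bracket (w i) (v j) + bracket (v i) (w j)) / bracket (v i) (v j) ^ 2) • v j)

theorem hasDerivAt_bracket {v w : ℂ → ℂ × ℂ} {v' w' : ℂ × ℂ} {s : ℂ} (hv : HasDerivAt v v' s)
    (hw : HasDerivAt w w' s) :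
    HasDerivAt (fun s => bracket (v s) (w s)) (bracket v' (w s) + bracket (v s) w') s := by
  have hv₁ : HasDerivAt (fun s => (v s).1) v'.1 s := hv.fst
  have hv₂ : HasDerivAt (fun s => (v s).2) v'.2 s := hv.snd
  have hw₁ : HasDerivAt (fun s => (w s).1) w'.1 s := hw.fst
  have hw₂ : HasDerivAt (fun s => (w s).2) w'.2 s := hw.snd
  exact ((hv₁.fun_mul hw₂).fun_sub (hv₂.fun_mul hw₁)).congr_deriv (by simp only [bracket]; ring)

theorem IsCollisionFree.hasDerivAt_stepVec {z : Fin n → P1} {v : ℂ → Fin n → ℂ × ℂ}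
    {v' : Fin n → ℂ × ℂ} {s : ℂ} (h : IsCollisionFree α z) (hz : IsHomLift (v s) z)
    (hv : HasDerivAt v v' s) (i : Fin n) :
    HasDerivAt (fun s => stepVec α (v s) i) (stepVecDeriv α (v s) v' i) s := by
  have hasDerivAt_apply (j : Fin n) : HasDerivAt (fun s => v s j) (v' j) s := hasDerivAt_pi.1 hv j
  refine .fun_sub (.fun_sum fun k _ => ?_) (.fun_sum fun j hj => ?_)
  · refine (((hasDerivAt_bracket (hasDerivAt_apply i) (hasDerivAt_const s (α k, 1))).fun_inv
      (h.bracket_root_ne_zero hz i k)).smul_const (α k, (1 : ℂ))).congr_deriv ?_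
    have bracket_zero : bracket (v s i) 0 = 0 := by simp [bracket]
    rw [bracket_zero, add_zero, neg_div]
  · refine (((hasDerivAt_bracket (hasDerivAt_apply i) (hasDerivAt_apply j)).fun_inv
      (h.bracket_ne_zero hz hj)).fun_smul (hasDerivAt_apply j)).congr_deriv ?_
    rw [neg_div, neg_smul, sub_eq_add_neg]

theorem hasDerivAt_chart1_ofHom {c : P1} {u : ℂ → ℂ × ℂ} {u' : ℂ × ℂ} {s : ℂ}
    (hu : HasDerivAt u u' s) (hne : chartDen c (u s) ≠ 0) :
    HasDerivAt (fun s => chart1 c (ofHom (u s)))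
      (c.elim (bracket (u s) u' / (u s).1 ^ 2) fun _ => -bracket (u s) u' / (u s).2 ^ 2) s := by
  have hu₁ : HasDerivAt (fun s => (u s).1) u'.1 s := hu.fst
  have hu₂ : HasDerivAt (fun s => (u s).2) u'.2 s := hu.snd
  simp only [chart1_ofHom]
  induction c using OnePoint.rec
  · exact (hu₂.fun_div hu₁ hne).congr_deriv (by simp only [OnePoint.elim_infty, bracket]; ring)
  · exact (hu₁.fun_div hu₂ hne).congr_deriv (by simp only [OnePoint.elim_some, bracket]; ring)

theorem hasDerivAt_chartLift_line (c : Fin n → P1) (t h : Fin n → ℂ) (s : ℂ) :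
    HasDerivAt (fun s : ℂ => chartLift c (t + s • h)) (chartLiftDeriv c h) s := by
  refine hasDerivAt_pi.2 fun i => ?_
  have hasDerivAt_coord : HasDerivAt (fun s : ℂ => t i + s * h i) (h i) s := by
    simpa using ((hasDerivAt_id s).mul_const (h i)).const_add (t i)
  simp only [chartLift, chartLift1, chartLiftDeriv, Pi.add_apply, Pi.smul_apply, smul_eq_mul]
  induction c i using OnePoint.rec
  · exact (hasDerivAt_const s 1).prodMk hasDerivAt_coord
  · exact hasDerivAt_coord.prodMk (hasDerivAt_const s 1)

theorem IsTwistedFixedPoint.fderiv_localMap_apply (H : IsTwistedFixedPoint α c σ)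
    (h : Fin n → ℂ) (i : Fin n) {u u' : ℂ × ℂ} (hu : stepVec α (fun j => hom (c j)) (σ i) = u)
    (hu' : stepVecDeriv α (fun j => hom (c j)) (chartLiftDeriv c h) (σ i) = u') :
    fderiv ℂ (localMap α c σ) (chart c c) h i =
      (c i).elim (bracket u u' / u.1 ^ 2) fun _ => -bracket u u' / u.2 ^ 2 := by
  subst hu hu'
  have line_deriv : HasLineDerivAt ℂ _ (fderiv ℂ (localMap α c σ) (chart c c) h) _ h :=
    ((H.contDiffAt_localMap.differentiableAt one_ne_zero).hasFDerivAt.hasLineDerivAt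
      h).congr_of_eventuallyEq H.localMap_eventuallyEq.symm
  refine (hasDerivAt_pi.1 line_deriv i).unique ?_
  have lift_zero : chartLift c (chart c c + (0 : ℂ) • h) = fun j => hom (c j) := by
    rw [zero_smul, add_zero, chartLift_chart]
  have stepVec_deriv := H.isCollisionFree.hasDerivAt_stepVec (s := 0)
    (lift_zero ▸ isHomLift_hom c) (hasDerivAt_chartLift_line c (chart c c) h 0) (σ i)
  have := hasDerivAt_chart1_ofHom (c := c i) stepVec_deriv (by
    rw [lift_zero, ← chartLift_chart]; exact H.chartDen_stepVec_ne_zero i)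
  simpa only [lift_zero] using this

theorem IsCollisionFree.bracket_stepVecDeriv {z : Fin n → P1} {v : Fin n → ℂ × ℂ}
    (h : IsCollisionFree α z) (hv : IsHomLift v z) (w : Fin n → ℂ × ℂ) (i : Fin n) :
    bracket (v i) (stepVecDeriv α v w i) = -bracket (w i) (stepVec α v i) := by
  simp only [stepVec, stepVecDeriv, bracket_sub_right, bracket_sum_right, bracket_smul_right]
  rw [neg_sub', ← Finset.sum_neg_distrib, ← Finset.sum_neg_distrib]
  refine congrArg₂ _ (Finset.sum_congr rfl fun k _ => ?_) (Finset.sum_congr rfl fun j hj => ?_)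
  · have := h.bracket_root_ne_zero hv i k
    field_simp
  · have := h.bracket_ne_zero hv hj
    field_simp
    ring

namespace IsTwistedFixedPoint

theorem fderiv_localMap_apply_infty_of_coe (H : IsTwistedFixedPoint α c σ) (h : Fin n → ℂ)
    {i : Fin n} {t : ℂ} (hi : c i = ∞) (hσi : c (σ i) = t) :
    fderiv ℂ (localMap α c σ) (chart c c) h i =
      -(stepVecDeriv α (fun j => hom (c j)) (chartLiftDeriv c h) (σ i)).2 := by
  have bracket_u := H.isCollisionFree.bracket_stepVec (isHomLift_hom c) (σ i)
  have snd_u := ofHom_eq_infty_iff.1 ((H.ofHom_stepVec i).trans hi)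
  rw [H.fderiv_localMap_apply h i rfl rfl, hi, OnePoint.elim_infty]
  generalize stepVec α (fun j => hom (c j)) (σ i) = u at *
  simp only [hσi, hom_coe, bracket, snd_u] at bracket_u ⊢
  have fst_u : u.1 = -1 := by linear_combination -bracket_u
  rw [fst_u]
  ring

theorem fderiv_localMap_apply_coe_of_infty (H : IsTwistedFixedPoint α c σ) (h : Fin n → ℂ)
    {i : Fin n} {x : ℂ} (hi : c i = x) (hσi : c (σ i) = ∞) :
    fderiv ℂ (localMap α c σ) (chart c c) h i =
      (stepVecDeriv α (fun j => hom (c j)) (chartLiftDeriv c h) (σ i)).1 - h (σ i) * x ^ 2 := by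
  have bracket_u := H.isCollisionFree.bracket_stepVec (isHomLift_hom c) (σ i)
  have bracket_u' := H.isCollisionFree.bracket_stepVecDeriv (isHomLift_hom c)
    (chartLiftDeriv c h) (σ i)
  have div_u := (ofHom_eq_coe_iff.1 ((H.ofHom_stepVec i).trans hi)).2
  rw [H.fderiv_localMap_apply h i rfl rfl, hi, OnePoint.elim_some]
  generalize stepVec α (fun j => hom (c j)) (σ i) = u at *
  generalize stepVecDeriv α (fun j => hom (c j)) (chartLiftDeriv c h) (σ i) = u' at *
  simp only [hσi, hom_infty, bracket, chartLiftDeriv, OnePoint.elim_infty, one_mul, zero_mul,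
    sub_zero, zero_sub, neg_neg] at bracket_u bracket_u' ⊢
  rw [bracket_u, div_one] at div_u
  rw [bracket_u, bracket_u', div_u]
  ring

theorem fderiv_localMap_apply_coe_of_coe (H : IsTwistedFixedPoint α c σ) (h : Fin n → ℂ)
    {i : Fin n} {x t : ℂ} (hi : c i = x) (hσi : c (σ i) = t) :
    fderiv ℂ (localMap α c σ) (chart c c) h i = h (σ i) +
      (stepVecDeriv α (fun j => hom (c j)) (chartLiftDeriv c h) (σ i)).2 /
        (stepVec α (fun j => hom (c j)) (σ i)).2 ^ 2 := by
  have bracket_u := H.isCollisionFree.bracket_stepVec (isHomLift_hom c) (σ i)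
  have bracket_u' := H.isCollisionFree.bracket_stepVecDeriv (isHomLift_hom c)
    (chartLiftDeriv c h) (σ i)
  have snd_u := (ofHom_eq_coe_iff.1 ((H.ofHom_stepVec i).trans hi)).1
  rw [H.fderiv_localMap_apply h i rfl rfl, hi, OnePoint.elim_some]
  generalize stepVec α (fun j => hom (c j)) (σ i) = u at *
  generalize stepVecDeriv α (fun j => hom (c j)) (chartLiftDeriv c h) (σ i) = u' at *
  simp only [hσi, hom_coe, bracket, chartLiftDeriv, OnePoint.elim_some, one_mul, zero_mul,
    sub_zero] at bracket_u bracket_u' ⊢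
  field_simp
  linear_combination u'.2 * bracket_u - u.2 * bracket_u'

end IsTwistedFixedPoint

end Derivative

section SaddleCycle

variable {n : ℕ} {F : Type*} [NormedAddCommGroup F] [NormedSpace ℂ F]

theorem charpoly_smul_id (l : ℂ) : (l • LinearMap.id : ℂ →ₗ[ℂ] ℂ).charpoly = X - C l := by
  rw [← LinearMap.charpoly_toMatrix _ (Module.Basis.singleton Unit ℂ), Matrix.charpoly,
    Matrix.det_unique, Matrix.charmatrix_apply_eq, LinearMap.toMatrix_apply]
  simp

theorem one_lt_norm_of_mem_roots_charpoly [FiniteDimensional ℂ F] {B : F →ₗ[ℂ] F}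
    (hB : ∀ y ≠ 0, ‖y‖ < ‖B y‖) {μ : ℂ} (hμ : μ ∈ B.charpoly.roots) : 1 < ‖μ‖ := by
  obtain ⟨y, hy⟩ := ((Module.End.hasEigenvalue_iff_isRoot_charpoly B μ).2
    (isRoot_of_mem_roots hμ)).exists_hasEigenvector
  have expands := hB y hy.2
  rw [hy.apply_eq_smul, norm_smul] at expands
  exact lt_of_mul_lt_mul_right (by rwa [one_mul]) (norm_nonneg y)

theorem isHyperbolicOneAttracting_of_conj [FiniteDimensional ℂ F]
    {L : (Fin n → ℂ) →L[ℂ] (Fin n → ℂ)} {P : (ℂ × F) ≃ₗ[ℂ] (Fin n → ℂ)} {l : ℂ} {B : F →ₗ[ℂ] F}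
    (hl₀ : l ≠ 0) (hl : ‖l‖ < 1) (hB : ∀ y ≠ 0, ‖y‖ < ‖B y‖)
    (hL : ∀ p, L (P p) = P (l * p.1, B p.2)) : IsHyperbolicOneAttracting L := by
  have conj_eq : L.toLinearMap = P.conj ((l • LinearMap.id).prodMap B) := by
    refine LinearMap.ext fun t => ?_
    obtain ⟨p, rfl⟩ := P.surjective t
    simpa [LinearEquiv.conj_apply] using hL p
  have roots_eq : L.toLinearMap.charpoly.roots = l ::ₘ B.charpoly.roots := by
    rw [conj_eq, LinearEquiv.charpoly_conj, LinearMap.charpoly_prodMap, charpoly_smul_id,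
      roots_mul ((monic_X_sub_C l).mul B.charpoly_monic).ne_zero, roots_X_sub_C,
      Multiset.singleton_add]
  have filter_roots : B.charpoly.roots.filter (fun μ => ‖μ‖ < 1) = 0 :=
    Multiset.filter_eq_nil.2 fun μ hμ => (one_lt_norm_of_mem_roots_charpoly hB hμ).le.not_gt
  rw [IsHyperbolicOneAttracting, roots_eq]
  refine ⟨Multiset.forall_mem_cons.2 ⟨⟨hl₀, hl.ne⟩, fun μ hμ => ?_⟩, ?_⟩
  · have one_lt := one_lt_norm_of_mem_roots_charpoly hB hμ
    exact ⟨norm_pos_iff.1 (zero_lt_one.trans one_lt), one_lt.ne'⟩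
  · rw [Multiset.filter_cons_of_pos (p := fun x => ‖x‖ < 1) _ hl, filter_roots,
      Multiset.card_cons, Multiset.card_zero]

theorem norm_lt_norm_apply {B : F ≃L[ℂ] F} (hB : ‖(B.symm : F →L[ℂ] F)‖ < 1) {y : F} (hy : y ≠ 0) :
    ‖y‖ < ‖B y‖ := by
  have norm_le := (B.symm : F →L[ℂ] F).le_opNorm (B y)
  rw [ContinuousLinearEquiv.coe_coe, B.symm_apply_apply] at norm_le
  exact norm_le.trans_lt
    (mul_lt_of_lt_one_left (norm_pos_iff.2 (B.map_ne_zero_iff.2 hy)) hB)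

theorem IsTwistedFixedPoint.exists_isLocalStableDisc [FiniteDimensional ℂ F] {α : Fin n → ℂ}
    {c : Fin n → P1} {σ : Equiv.Perm (Fin n)} (H : IsTwistedFixedPoint α c σ)
    (hc : c ∉ finitePart n) {P : (ℂ × F) ≃L[ℂ] (Fin n → ℂ)} {l : ℂ} {B : F ≃L[ℂ] F}
    (hl₀ : l ≠ 0) (hl : ‖l‖ < 1) (hB : ‖(B.symm : F →L[ℂ] F)‖ < 1)
    (hP : ∀ p, fderiv ℂ (localMap α c σ) (chart c c) (P p) = P (l * p.1, B p.2))
    (hcone : ∀ a y i, c i = ∞ → a ≠ 0 → ‖y‖ ≤ ‖a‖ → P (a, y) i ≠ 0) :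
    ∃ L : (Fin n → ℂ) →L[ℂ] (Fin n → ℂ), HasFDerivAt (localReturn α c) L (chart c c) ∧
      IsHyperbolicOneAttracting L ∧ ∃ γ : ℂ → Fin n → ℂ, IsLocalStableDisc α c L γ ∧
        ∀ s ∈ Metric.ball (0 : ℂ) 1, s ≠ 0 → ∃ Z : ℕ → Fin n → ℂ,
          incl (Z 0) = chartInv c (γ s) ∧ IsAffineOrbit (rootPoly α) Z ∧
            Tendsto (fun k => ‖Z k‖) atTop atTop := by
  have : CompleteSpace F := FiniteDimensional.complete ℂ F
  obtain ⟨V, hV, localForm, cont⟩ := H.exists_isTwistedLocalForm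
  obtain ⟨N, γ, r, hNV, disc, deriv_γ, cone⟩ :=
    exists_isStableDisc hl₀ hl hB H.localMap_chart H.contDiffAt_localMap hP hV
  set M := fderiv ℂ (localMap α c σ) (chart c c)
  have M_comp_M (p : ℂ × F) : M.comp M (P p) = P (l ^ 2 * p.1, B (B p.2)) := by
    rw [ContinuousLinearMap.comp_apply, hP, hP, sq, mul_assoc]
  have norm_sq_lt : ‖l ^ 2‖ < 1 := by
    rw [norm_pow]
    exact pow_lt_one₀ (norm_nonneg l) hl two_ne_zero
  refine ⟨M.comp M, localForm.hasFDerivAt_localReturn hV H.localMap_chart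
    (H.contDiffAt_localMap.differentiableAt one_ne_zero).hasFDerivAt,
    isHyperbolicOneAttracting_of_conj (P := P.toLinearEquiv)
      (B := B.toLinearMap ∘ₗ B.toLinearMap) (pow_ne_zero 2 hl₀) norm_sq_lt
      (fun y hy => (norm_lt_norm_apply hB hy).trans
        (norm_lt_norm_apply hB (B.map_ne_zero_iff.2 hy))) M_comp_M,
    γ, (localForm.mono hNV).isLocalStableDisc disc H.localMap_chart (cont.mono hNV) norm_sq_lt ?_,
    fun s hs hs₀ => (localForm.mono hNV).exists_divergent_isAffineOrbit hc ?_ ?_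
      (disc.tendsto s hs)⟩
  · have eigenvector : M.comp M (P (1, 0)) = l ^ 2 • P (1, 0) := by
      rw [M_comp_M, ← P.map_smul, map_zero, map_zero, Prod.smul_mk, smul_zero, smul_eq_mul]
    rw [deriv_γ, ← Complex.coe_smul, map_smul, eigenvector, smul_comm]
  · have := Set.mem_image_of_mem γ hs
    rwa [disc.image_eq] at this
  · intro k i hi
    obtain ⟨a, y, ha, hya, iterate_eq⟩ := cone s hs hs₀ k
    rw [iterate_eq, Pi.add_apply, chart, hi]
    simpa [chart1] using hcone a y i hi ha hya

end SaddleCycle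

section Parallelogram

/-- The vertices of the parallelogram with centre `m` and half-diagonals `a` and `b`. -/
def parallelogram (m a b : ℂ) : Fin 4 → ℂ := ![m + a, m + b, m - a, m - b]

/-- `a` and `b` are half-diagonals of a parallelogram with four distinct vertices, and `c` is one of
their two geometric means. -/
structure IsGeometricMean (a b c : ℂ) : Prop where
  left_ne_zero : a ≠ 0
  right_ne_zero : b ≠ 0
  sub_ne_zero : a - b ≠ 0
  add_ne_zero : a + b ≠ 0
  sq_eq : c ^ 2 = a * b

/-- A point of the two-cycle for the parallelogram with centre `m` and half-diagonals of geometric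
mean `c`. -/
def cyclePt (m c : ℂ) : Fin 4 → P1 := ![∞, (m : ℂ), (m + c : ℂ), (m - c : ℂ)]

/-- The permutation by which the Jacobi Ehrlich–Aberth map acts on the coordinates of `cyclePt`. -/
def swapPairs : Equiv.Perm (Fin 4) := Equiv.swap 0 1 * Equiv.swap 2 3

variable {m a b c : ℂ}

theorem swapPairs_sq : swapPairs ^ 2 = 1 := by decide

theorem swapPairs_ne_one : swapPairs ≠ 1 := by decide

theorem cyclePt_notMem_finitePart (m c : ℂ) : cyclePt m c ∉ finitePart 4 :=
  fun ⟨z, hz⟩ => OnePoint.coe_ne_infty (z 0) (congrFun hz 0)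

theorem cyclePt_comp_swapPairs_notMem_finitePart (m c : ℂ) :
    cyclePt m c ∘ swapPairs ∉ finitePart 4 :=
  fun ⟨z, hz⟩ => OnePoint.coe_ne_infty (z 1) (congrFun hz 1)

theorem isGeometricMean_of_injective (h : Function.Injective (parallelogram m a b))
    (hc : c ^ 2 = a * b) : IsGeometricMean a b c where
  left_ne_zero ha := absurd (h (a₁ := 0) (a₂ := 2) (by simp [parallelogram, ha])) (by decide)
  right_ne_zero hb := absurd (h (a₁ := 1) (a₂ := 3) (by simp [parallelogram, hb])) (by decide)
  sub_ne_zero hab := absurd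
    (h (a₁ := 0) (a₂ := 1) (by simp [parallelogram, sub_eq_zero.1 hab])) (by decide)
  add_ne_zero hab := absurd
    (h (a₁ := 0) (a₂ := 3)
      (by simp [parallelogram, eq_neg_of_add_eq_zero_left hab, ← sub_eq_add_neg]))
    (by decide)
  sq_eq := hc

theorem IsParallelogram.exists_eq_parallelogram {α : Fin 4 → ℂ} (h : IsParallelogram α) :
    ∃ m a b c, α = parallelogram m a b ∧ IsGeometricMean a b c := by
  obtain ⟨injective, sum_eq⟩ := h
  obtain ⟨m, hm⟩ : ∃ m, 2 * m = α 0 + α 2 := ⟨(α 0 + α 2) / 2, mul_div_cancel₀ _ two_ne_zero⟩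
  obtain ⟨c, hc⟩ := IsAlgClosed.exists_pow_nat_eq ((α 0 - m) * (α 1 - m)) two_pos
  have eq_parallelogram : α = parallelogram m (α 0 - m) (α 1 - m) := by
    funext i
    fin_cases i
    · exact (add_sub_cancel m (α 0)).symm
    · exact (add_sub_cancel m (α 1)).symm
    · change α 2 = m - (α 0 - m)
      linear_combination -hm
    · change α 3 = m - (α 1 - m)
      linear_combination -hm - sum_eq
  exact ⟨m, _, _, c, eq_parallelogram,
    isGeometricMean_of_injective (eq_parallelogram ▸ injective) hc⟩

namespace IsGeometricMean

theorem ne_zero (h : IsGeometricMean a b c) : c ≠ 0 := by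
  have sq_ne_zero : c ^ 2 ≠ 0 := h.sq_eq ▸ mul_ne_zero h.left_ne_zero h.right_ne_zero
  exact (pow_ne_zero_iff two_ne_zero).1 sq_ne_zero

theorem symm (h : IsGeometricMean a b c) : IsGeometricMean b a c :=
  ⟨h.right_ne_zero, h.left_ne_zero, _root_.sub_ne_zero.2 (_root_.sub_ne_zero.1 h.sub_ne_zero).symm,
    add_comm a b ▸ h.add_ne_zero, mul_comm a b ▸ h.sq_eq⟩

theorem neg (h : IsGeometricMean a b c) : IsGeometricMean a b (-c) :=
  { h with sq_eq := (neg_sq c).trans h.sq_eq }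

theorem sub_left_ne_zero (h : IsGeometricMean a b c) : c - a ≠ 0 := fun hca => by
  have mul_eq_zero : a * (a - b) = 0 := by linear_combination h.sq_eq - (c + a) * hca
  exact mul_ne_zero h.left_ne_zero h.sub_ne_zero mul_eq_zero

theorem sub_right_ne_zero (h : IsGeometricMean a b c) : c - b ≠ 0 := h.symm.sub_left_ne_zero

theorem add_left_ne_zero (h : IsGeometricMean a b c) : c + a ≠ 0 := fun hca =>
  h.neg.sub_left_ne_zero (by linear_combination -hca)

theorem add_right_ne_zero (h : IsGeometricMean a b c) : c + b ≠ 0 := h.symm.add_left_ne_zero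

theorem isCollisionFree (h : IsGeometricMean a b c) (m : ℂ) :
    IsCollisionFree (parallelogram m a b) (cyclePt m c) where
  ne_root i k := by
    have := h.left_ne_zero
    have := h.right_ne_zero
    have := h.sub_left_ne_zero
    have := h.sub_right_ne_zero
    have := h.add_left_ne_zero
    have := h.add_right_ne_zero
    fin_cases i <;> fin_cases k <;> simp [cyclePt, parallelogram] <;> grind
  injective := by
    have := h.ne_zero
    intro i j hij
    fin_cases i <;> fin_cases j <;> simp [cyclePt] at hij ⊢ <;> grind

theorem sum_inv_sub (h : IsGeometricMean a b c) :
    (c - a)⁻¹ + (c - b)⁻¹ + (c + a)⁻¹ + (c + b)⁻¹ = 2 / c := by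
  have := h.ne_zero
  have := h.sub_left_ne_zero
  have := h.sub_right_ne_zero
  have := h.add_left_ne_zero
  have := h.add_right_ne_zero
  field_simp
  linear_combination (2 * c ^ 2 + 2 * a * b) * h.sq_eq

theorem inv_sub_sq_add_inv_add_sq (h : IsGeometricMean a b c) :
    ((c - a) ^ 2)⁻¹ + ((c + a) ^ 2)⁻¹ = 2 * (a + b) / (a * (a - b) ^ 2) := by
  have := h.left_ne_zero
  have := h.sub_left_ne_zero
  have := h.add_left_ne_zero
  have := h.sub_ne_zero
  have sub_sq_eq : (c - a) ^ 2 = a * (a + b - 2 * c) := by linear_combination h.sq_eq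
  have add_sq_eq : (c + a) ^ 2 = a * (a + b + 2 * c) := by linear_combination h.sq_eq
  have prod_eq : (a + b - 2 * c) * (a + b + 2 * c) = (a - b) ^ 2 := by
    linear_combination -4 * h.sq_eq
  field_simp
  rw [sub_sq_eq, add_sq_eq]
  linear_combination -2 * a ^ 2 * (a + b) * prod_eq

theorem sum_inv_sub_sq (h : IsGeometricMean a b c) :
    ((c - a) ^ 2)⁻¹ + ((c - b) ^ 2)⁻¹ + ((c + a) ^ 2)⁻¹ + ((c + b) ^ 2)⁻¹ =
      2 / c ^ 2 + 8 / (a - b) ^ 2 := by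
  have := h.left_ne_zero
  have := h.right_ne_zero
  have := h.sub_ne_zero
  have add_comm_sq : ((c - a) ^ 2)⁻¹ + ((c - b) ^ 2)⁻¹ + ((c + a) ^ 2)⁻¹ + ((c + b) ^ 2)⁻¹ =
      2 * (a + b) / (a * (a - b) ^ 2) + 2 * (b + a) / (b * (b - a) ^ 2) := by
    rw [← h.inv_sub_sq_add_inv_add_sq, ← h.symm.inv_sub_sq_add_inv_add_sq]
    ring
  rw [add_comm_sq, sub_sq_comm b a, h.sq_eq]
  field_simp
  ring

end IsGeometricMean

/-- The additional summand `j = i` vanishes because `0⁻¹ = 0`. -/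
theorem stepVec_eq_sub_sum_univ {n : ℕ} (α : Fin n → ℂ) (v : Fin n → ℂ × ℂ) (i : Fin n) :
    stepVec α v i = ∑ k, (bracket (v i) (α k, 1))⁻¹ • (α k, 1) -
      ∑ j, (bracket (v i) (v j))⁻¹ • v j := by
  rw [stepVec, Finset.sum_erase]
  simp [bracket, mul_comm]

theorem stepVecDeriv_eq_sub_sum_univ {n : ℕ} (α : Fin n → ℂ) (v w : Fin n → ℂ × ℂ) (i : Fin n) :
    stepVecDeriv α v w i =
      ∑ k, -(bracket (w i) (α k, 1) / bracket (v i) (α k, 1) ^ 2) • (α k, 1) -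
        ∑ j, ((bracket (v i) (v j))⁻¹ • w j -
          ((bracket (w i) (v j) + bracket (v i) (w j)) / bracket (v i) (v j) ^ 2) • v j) := by
  rw [stepVecDeriv, Finset.sum_erase]
  simp [bracket, mul_comm]

theorem stepVec_cyclePt_zero (m a b c : ℂ) :
    stepVec (parallelogram m a b) (fun j => hom (cyclePt m c j)) 0 = (m, 1) := by
  rw [stepVec_eq_sub_sum_univ]
  ext
  · simp only [Prod.fst_sub, Prod.fst_add, Prod.smul_fst, smul_eq_mul, Fin.sum_univ_four,
      Matrix.cons_val, parallelogram, cyclePt, hom_coe, hom_infty, bracket]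
    ring
  · simp [Fin.sum_univ_four, cyclePt, bracket]

theorem stepVec_cyclePt_one_snd (m a b c : ℂ) :
    (stepVec (parallelogram m a b) (fun j => hom (cyclePt m c j)) 1).2 = 0 := by
  rw [stepVec_eq_sub_sum_univ]
  simp [Fin.sum_univ_four, parallelogram, cyclePt, bracket]

theorem stepVecDeriv_cyclePt_zero_fst (h : Fin 4 → ℂ) :
    (stepVecDeriv (parallelogram m a b) (fun j => hom (cyclePt m c j))
      (chartLiftDeriv (cyclePt m c) h) 0).1 =
        h 0 * (m ^ 2 + 2 * a ^ 2 + 2 * b ^ 2 - 2 * c ^ 2) - (h 1 + h 2 + h 3) := by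
  rw [stepVecDeriv_eq_sub_sum_univ]
  simp only [Prod.fst_sub, Prod.fst_add, Prod.smul_fst, smul_eq_mul, Fin.sum_univ_four,
    Matrix.cons_val, parallelogram, cyclePt, hom_coe, hom_infty, bracket, chartLiftDeriv,
      OnePoint.elim_some, OnePoint.elim_infty]
  ring

theorem stepVecDeriv_cyclePt_one_snd (h : Fin 4 → ℂ) :
    (stepVecDeriv (parallelogram m a b) (fun j => hom (cyclePt m c j))
      (chartLiftDeriv (cyclePt m c) h) 1).2 =
        -h 1 * (2 / a ^ 2 + 2 / b ^ 2) + h 0 + (2 * h 1 - h 2 - h 3) / c ^ 2 := by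
  rw [stepVecDeriv_eq_sub_sum_univ]
  simp only [Prod.snd_sub, Prod.snd_add, Prod.smul_snd, smul_eq_mul, Fin.sum_univ_four,
    Matrix.cons_val, parallelogram, cyclePt, hom_coe, hom_infty, bracket, chartLiftDeriv,
      OnePoint.elim_some, OnePoint.elim_infty]
  ring

/-- The derivative of `localMap` at the point `cyclePt m c`, where `w = -2 (a - b)² / c²`. -/
def linPart (c w : ℂ) (h : Fin 4 → ℂ) : Fin 4 → ℂ :=
  ![(2 - w) / c ^ 2 * h 1 + (h 2 + h 3) / c ^ 2 - h 0,
    (2 - w) * c ^ 2 * h 0 - (h 1 + h 2 + h 3),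
    (64 / w - 2) * h 3 - h 2 + 4 * c ^ 2 * h 0 - 4 * h 1,
    (64 / w - 2) * h 2 - h 3 + 4 * c ^ 2 * h 0 - 4 * h 1]

namespace IsGeometricMean

theorem stepVec_cyclePt_two_snd (h : IsGeometricMean a b c) (m : ℂ) :
    (stepVec (parallelogram m a b) (fun j => hom (cyclePt m c j)) 2).2 = 1 / (2 * c) := by
  have sum_inv_sub := h.sum_inv_sub
  rw [stepVec_eq_sub_sum_univ]
  simp only [Prod.snd_sub, Prod.snd_add, Prod.smul_snd, smul_eq_mul, Fin.sum_univ_four,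
    Matrix.cons_val, parallelogram, cyclePt, hom_coe, hom_infty, bracket]
  linear_combination sum_inv_sub

theorem stepVec_cyclePt_three_snd (h : IsGeometricMean a b c) (m : ℂ) :
    (stepVec (parallelogram m a b) (fun j => hom (cyclePt m c j)) 3).2 = -1 / (2 * c) := by
  have sum_inv_sub := h.neg.sum_inv_sub
  rw [stepVec_eq_sub_sum_univ]
  simp only [Prod.snd_sub, Prod.snd_add, Prod.smul_snd, smul_eq_mul, Fin.sum_univ_four,
    Matrix.cons_val, parallelogram, cyclePt, hom_coe, hom_infty, bracket]
  linear_combination sum_inv_sub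

theorem isTwistedFixedPoint (h : IsGeometricMean a b c) (m : ℂ) :
    IsTwistedFixedPoint (parallelogram m a b) (cyclePt m c) swapPairs where
  sq_eq_one := swapPairs_sq
  isCollisionFree := h.isCollisionFree m
  JEA_eq := by
    have free := h.isCollisionFree m
    have c_ne_zero := h.ne_zero
    have snd_two := h.stepVec_cyclePt_two_snd m
    have snd_three := h.stepVec_cyclePt_three_snd m
    funext i
    fin_cases i
    · rw [free.JEA_apply (isHomLift_hom _)]
      exact (congrArg ofHom (stepVec_cyclePt_zero m a b c)).trans (ofHom_coe_one m)
    · rw [free.JEA_apply (isHomLift_hom _)]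
      exact ofHom_eq_infty_iff.2 (stepVec_cyclePt_one_snd m a b c)
    · refine (free.JEA_apply_of_coe (i := 2) rfl (by rw [snd_two]; simp [c_ne_zero])).trans
        (congrArg _ ?_)
      rw [snd_two]
      field_simp
      ring
    · refine (free.JEA_apply_of_coe (i := 3) rfl (by rw [snd_three]; simp [c_ne_zero])).trans
        (congrArg _ ?_)
      rw [snd_three]
      field_simp
      ring

theorem stepVecDeriv_cyclePt_two_snd (H : IsGeometricMean a b c) (h : Fin 4 → ℂ) :
    (stepVecDeriv (parallelogram m a b) (fun j => hom (cyclePt m c j))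
      (chartLiftDeriv (cyclePt m c) h) 2).2 =
        -h 2 * (2 / c ^ 2 + 8 / (a - b) ^ 2) + h 0 + (h 2 - h 1) / c ^ 2 +
          (h 2 - h 3) / (4 * c ^ 2) := by
  rw [stepVecDeriv_eq_sub_sum_univ, ← H.sum_inv_sub_sq]
  simp only [Prod.snd_sub, Prod.snd_add, Prod.smul_snd, smul_eq_mul, Fin.sum_univ_four,
    Matrix.cons_val, parallelogram, cyclePt, hom_coe, hom_infty, bracket, chartLiftDeriv,
      OnePoint.elim_some, OnePoint.elim_infty]
  ring

theorem stepVecDeriv_cyclePt_three_snd (H : IsGeometricMean a b c) (h : Fin 4 → ℂ) :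
    (stepVecDeriv (parallelogram m a b) (fun j => hom (cyclePt m c j))
      (chartLiftDeriv (cyclePt m c) h) 3).2 =
        -h 3 * (2 / c ^ 2 + 8 / (a - b) ^ 2) + h 0 + (h 3 - h 1) / c ^ 2 +
          (h 3 - h 2) / (4 * c ^ 2) := by
  have := H.neg.sum_inv_sub_sq
  rw [neg_sq] at this
  rw [stepVecDeriv_eq_sub_sum_univ, ← this]
  simp only [Prod.snd_sub, Prod.snd_add, Prod.smul_snd, smul_eq_mul, Fin.sum_univ_four,
    Matrix.cons_val, parallelogram, cyclePt, hom_coe, hom_infty, bracket, chartLiftDeriv,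
      OnePoint.elim_some, OnePoint.elim_infty]
  ring

theorem fderiv_localMap_cyclePt (H : IsGeometricMean a b c) {w : ℂ}
    (hw : w * c ^ 2 = -2 * (a - b) ^ 2) (m : ℂ) (h : Fin 4 → ℂ) :
    fderiv ℂ (localMap (parallelogram m a b) (cyclePt m c) swapPairs)
      (chart (cyclePt m c) (cyclePt m c)) h = linPart c w h := by
  have fixed := H.isTwistedFixedPoint m
  have := H.ne_zero
  have := H.left_ne_zero
  have := H.right_ne_zero
  have := H.sub_ne_zero
  have w_ne_zero : w ≠ 0 := fun hw₀ => by simp [hw₀, H.sub_ne_zero] at hw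
  have div_w : 64 / w = -32 * c ^ 2 / (a - b) ^ 2 := by
    field_simp
    linear_combination 32 * hw
  funext i
  fin_cases i
  · refine (fixed.fderiv_localMap_apply_infty_of_coe (i := 0) h rfl rfl).trans ?_
    refine (congrArg Neg.neg (stepVecDeriv_cyclePt_one_snd h)).trans ?_
    have sum_inv_sq : 2 / a ^ 2 + 2 / b ^ 2 = (4 - w) / c ^ 2 := by
      rw [H.sq_eq] at hw ⊢
      field_simp
      linear_combination hw
    rw [sum_inv_sq]
    change _ = (2 - w) / c ^ 2 * h 1 + (h 2 + h 3) / c ^ 2 - h 0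
    ring
  · refine (fixed.fderiv_localMap_apply_coe_of_infty (i := 1) h rfl rfl).trans ?_
    refine (congrArg (· - h 0 * m ^ 2) (stepVecDeriv_cyclePt_zero_fst h)).trans ?_
    change _ = (2 - w) * c ^ 2 * h 0 - (h 1 + h 2 + h 3)
    linear_combination h 0 * hw - 4 * h 0 * H.sq_eq
  · refine (fixed.fderiv_localMap_apply_coe_of_coe (i := 2) h rfl rfl).trans ?_
    refine (congrArg₂ (fun x y => h 3 + x / y ^ 2) (H.stepVecDeriv_cyclePt_three_snd h)
      (H.stepVec_cyclePt_three_snd m)).trans ?_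
    change _ = (64 / w - 2) * h 3 - h 2 + 4 * c ^ 2 * h 0 - 4 * h 1
    rw [div_w]
    field_simp
    ring
  · refine (fixed.fderiv_localMap_apply_coe_of_coe (i := 3) h rfl rfl).trans ?_
    refine (congrArg₂ (fun x y => h 2 + x / y ^ 2) (H.stepVecDeriv_cyclePt_two_snd h)
      (H.stepVec_cyclePt_two_snd m)).trans ?_
    change _ = (64 / w - 2) * h 2 - h 3 + 4 * c ^ 2 * h 0 - 4 * h 1
    rw [div_w]
    field_simp
    ring

end IsGeometricMean

end Parallelogram

section Spectrum

variable {c w l l' : ℂ}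

/-- The linear coordinates given by eigenvectors of `linPart c w` for the eigenvalues `l`, `1 - w`,
`1 - 64 / w` and `l'`. The last three are scaled so that, where `‖p.2‖ ≤ ‖p.1‖`, the first entry
vanishes only for `p.1 = 0`. -/
def eigenEquiv (w : ℂ) (hc : c ≠ 0) (hl : l' - l ≠ 0) : (ℂ × (Fin 3 → ℂ)) ≃ₗ[ℂ] (Fin 4 → ℂ) where
  toFun p := ![(p.1 + (p.2 0 + p.2 2) / 4) / c, c * ((p.2 0 - p.2 2) / 4 - p.1),
    c * ((l + 3 - w) / 2 * p.1 + p.2 1 + (l' + 3 - w) / 8 * p.2 2),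
    c * ((l + 3 - w) / 2 * p.1 - p.2 1 + (l' + 3 - w) / 8 * p.2 2)]
  map_add' p q := by
    funext i
    fin_cases i <;> simp <;> ring
  map_smul' s p := by
    funext i
    fin_cases i <;> simp <;> ring
  invFun t := (((l' + 3 - w) * (c * t 0 - t 1 / c) / 2 - (t 2 + t 3) / c) / (l' - l),
    ![2 * (c * t 0 + t 1 / c), (t 2 - t 3) / (2 * c),
      4 * ((t 2 + t 3) / c - (l + 3 - w) * (c * t 0 - t 1 / c) / 2) / (l' - l)])
  left_inv p := by
    refine Prod.ext ?_ (funext fun i => ?_)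
    · simp only [Matrix.cons_val]
      field_simp
      ring
    · fin_cases i <;> simp <;> field_simp <;> ring
  right_inv t := by
    funext i
    fin_cases i <;> simp <;> field_simp <;> ring

theorem eigenEquiv_apply (hc : c ≠ 0) (hl : l' - l ≠ 0) (p : ℂ × (Fin 3 → ℂ)) :
    eigenEquiv w hc hl p = ![(p.1 + (p.2 0 + p.2 2) / 4) / c, c * ((p.2 0 - p.2 2) / 4 - p.1),
      c * ((l + 3 - w) / 2 * p.1 + p.2 1 + (l' + 3 - w) / 8 * p.2 2),
      c * ((l + 3 - w) / 2 * p.1 - p.2 1 + (l' + 3 - w) / 8 * p.2 2)] :=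
  rfl

theorem linPart_eigenEquiv (hc : c ≠ 0) (hl : l' - l ≠ 0) (hw : w ≠ 0)
    (hsum : l + l' = w + 64 / w - 6) (hprod : l * l' = 57 - 3 * (w + 64 / w))
    (p : ℂ × (Fin 3 → ℂ)) : linPart c w (eigenEquiv w hc hl p) =
      eigenEquiv w hc hl (l * p.1, fun i => ![1 - w, 1 - 64 / w, l'] i * p.2 i) := by
  have div_w : 64 / w = l + l' + 6 - w := by linear_combination -hsum
  have sq_w : w ^ 2 = (l + l' + 6) * w - 64 := by
    rw [hsum]
    field_simp
    ring
  rw [div_w] at hprod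
  funext i
  fin_cases i
  · simp only [linPart, eigenEquiv_apply, Fin.zero_eta, Matrix.cons_val]
    field_simp
    ring
  · simp only [linPart, eigenEquiv_apply, Fin.mk_one, Matrix.cons_val]
    field_simp
    ring
  · simp only [linPart, eigenEquiv_apply, Fin.reduceFinMk, Matrix.cons_val, div_w]
    field_simp
    linear_combination 2 * (4 * p.1 + p.2 2) * (hprod + sq_w)
  · simp only [linPart, eigenEquiv_apply, Fin.reduceFinMk, Matrix.cons_val, div_w]
    field_simp
    linear_combination 2 * (4 * p.1 + p.2 2) * (hprod + sq_w)

theorem eigenEquiv_apply_zero_ne_zero (hc : c ≠ 0) (hl : l' - l ≠ 0) {a : ℂ} {y : Fin 3 → ℂ}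
    (ha : a ≠ 0) (hy : ‖y‖ ≤ ‖a‖) : eigenEquiv w hc hl (a, y) 0 ≠ 0 := by
  have norm_sum_le : ‖y 0 + y 2‖ ≤ 2 * ‖a‖ := by
    linarith [norm_add_le (y 0) (y 2), norm_le_pi_norm y 0, norm_le_pi_norm y 2]
  refine div_ne_zero (fun h => ?_) hc
  have eq_neg : y 0 + y 2 = -4 * a := by linear_combination 4 * h
  rw [eq_neg, norm_mul, norm_neg, RCLike.norm_ofNat] at norm_sum_le
  linarith [norm_pos_iff.2 ha]

theorem exists_diagonal_norm_symm_lt_one {ι : Type*} [Fintype ι] {μ : ι → ℂ}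
    (hμ : ∀ i, 1 < ‖μ i‖) : ∃ B : (ι → ℂ) ≃L[ℂ] (ι → ℂ),
      (∀ y, B y = fun i => μ i * y i) ∧ ‖(B.symm : (ι → ℂ) →L[ℂ] (ι → ℂ))‖ < 1 := by
  have μ_ne_zero (i : ι) : μ i ≠ 0 := norm_pos_iff.1 (zero_lt_one.trans (hμ i))
  let B : (ι → ℂ) ≃L[ℂ] (ι → ℂ) := .piCongrRight fun i =>
    ContinuousLinearEquiv.unitsEquivAut ℂ (Units.mk0 (μ i) (μ_ne_zero i))
  have norm_inv_lt : ‖fun i => (μ i)⁻¹‖ < 1 := (pi_norm_lt_iff zero_lt_one).2 fun i => by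
    rw [norm_inv]
    exact inv_lt_one_of_one_lt₀ (hμ i)
  refine ⟨B, fun y => funext fun i => mul_comm _ _, lt_of_le_of_lt
    (ContinuousLinearMap.opNorm_le_bound _ (norm_nonneg _) fun y =>
      (pi_norm_le_iff_of_nonneg (by positivity)).2 fun i => ?_) norm_inv_lt⟩
  calc ‖B.symm y i‖ = ‖(μ i)⁻¹‖ * ‖y i‖ := by rw [mul_comm, ← norm_mul]; rfl
    _ ≤ _ := by gcongr; exacts [norm_le_pi_norm (fun i => (μ i)⁻¹) i, norm_le_pi_norm y i]

theorem exists_add_eq_mul_eq_norm_lt_one_lt_norm {S Q : ℂ} (h : 1 + ‖Q‖ < ‖S‖) :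
    ∃ x y : ℂ, x + y = S ∧ x * y = Q ∧ ‖x‖ < 1 ∧ 1 < ‖y‖ := by
  obtain ⟨D, hD⟩ := IsAlgClosed.exists_pow_nat_eq (S ^ 2 - 4 * Q) two_pos
  set x := (S + D) / 2
  set y := (S - D) / 2
  have sum_eq : x + y = S := by ring
  have prod_eq : x * y = Q := by linear_combination -hD / 4
  have norm_sum_le : ‖S‖ ≤ ‖x‖ + ‖y‖ := sum_eq ▸ norm_add_le x y
  have prod_neg : (1 - ‖x‖) * (1 - ‖y‖) < 0 := by
    rw [← prod_eq, norm_mul] at h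
    linarith
  obtain ⟨hx, hy⟩ | ⟨hx, hy⟩ := mul_neg_iff.1 prod_neg
  · exact ⟨x, y, sum_eq, prod_eq, sub_pos.1 hx, sub_neg.1 hy⟩
  · exact ⟨y, x, (add_comm y x).trans sum_eq, (mul_comm y x).trans prod_eq, sub_pos.1 hy,
      sub_neg.1 hx⟩

/-- The parameters `w` for which `linPart c w` is invertible and has three eigenvalues outside and
one inside the unit circle. Two of the eigenvalues are `1 - w` and `1 - 64 / w`, and the remaining
two have sum `w + 64 / w - 6` and product `57 - 3 * (w + 64 / w)`. -/
def saddleRegion : Set ℂ :=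
  {w | w ≠ 0 ∧ 1 < ‖1 - w‖ ∧ 1 < ‖1 - 64 / w‖ ∧ 57 - 3 * (w + 64 / w) ≠ 0 ∧
    1 + ‖57 - 3 * (w + 64 / w)‖ < ‖w + 64 / w - 6‖}

theorem isOpen_saddleRegion : IsOpen saddleRegion := by
  refine isOpen_iff_eventually.2 fun w ⟨w_ne_zero, h₁, h₂, prod_ne_zero, hsum⟩ => ?_
  have : ContinuousAt (fun w : ℂ => 64 / w) w :=
    continuousAt_const.div₀ continuousAt_id w_ne_zero
  have prod_cont : ContinuousAt (fun w : ℂ => 57 - 3 * (w + 64 / w)) w := by fun_prop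
  exact (eventually_ne_nhds w_ne_zero).and <|
    (ContinuousAt.eventually_lt (f := fun _ => (1 : ℝ)) (g := fun w => ‖1 - w‖)
      (by fun_prop) (by fun_prop) h₁).and <|
    (ContinuousAt.eventually_lt (f := fun _ => (1 : ℝ)) (g := fun w => ‖1 - 64 / w‖)
      (by fun_prop) (by fun_prop) h₂).and <|
    (prod_cont.eventually_ne prod_ne_zero).and <|
    ContinuousAt.eventually_lt (f := fun w => 1 + ‖57 - 3 * (w + 64 / w)‖)
      (g := fun w => ‖w + 64 / w - 6‖) (by fun_prop) (by fun_prop) hsum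

/-- The cross-ratios of the parallelograms whose two-cycle is a saddle with one attracting
direction. -/
def saddleCrossRatios : Set ℂ := {x | x ≠ 0 ∧ 8 - 8 / x ∈ saddleRegion}

theorem isOpen_saddleCrossRatios : IsOpen saddleCrossRatios := by
  refine isOpen_iff_eventually.2 fun x ⟨x_ne_zero, hx⟩ => ?_
  have cont : ContinuousAt (fun x : ℂ => 8 - 8 / x) x :=
    continuousAt_const.sub (continuousAt_const.div₀ continuousAt_id x_ne_zero)
  exact (eventually_ne_nhds x_ne_zero).and
    (cont.eventually (isOpen_saddleRegion.eventually_mem hx))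

theorem two_mem_saddleCrossRatios : 2 ∈ saddleCrossRatios := by
  have : (8 - 8 / 2 : ℂ) = 4 := by norm_num
  refine ⟨two_ne_zero, ?_⟩
  rw [this]
  refine ⟨?_, ?_, ?_, ?_, ?_⟩ <;> norm_num

namespace IsGeometricMean

variable {m a b : ℂ}

theorem eight_sub_eight_div_CR (H : IsGeometricMean a b c) (m : ℂ) :
    8 - 8 / CR (m + a) (m + b) (m - a) (m - b) = -2 * (a - b) ^ 2 / c ^ 2 := by
  have := H.left_ne_zero
  have := H.right_ne_zero
  have := H.add_ne_zero
  have CR_eq : CR (m + a) (m + b) (m - a) (m - b) = 4 * a * b / (a + b) ^ 2 := by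
    rw [CR]
    congr 1 <;> ring
  rw [CR_eq, H.sq_eq]
  field_simp
  ring

theorem exists_isLocalStableDisc (H : IsGeometricMean a b c)
    (hw : -2 * (a - b) ^ 2 / c ^ 2 ∈ saddleRegion) (m : ℂ) :
    ∃ L : (Fin 4 → ℂ) →L[ℂ] (Fin 4 → ℂ),
      HasFDerivAt (localReturn (parallelogram m a b) (cyclePt m c)) L
        (chart (cyclePt m c) (cyclePt m c)) ∧
      IsHyperbolicOneAttracting L ∧
      ∃ γ : ℂ → Fin 4 → ℂ, IsLocalStableDisc (parallelogram m a b) (cyclePt m c) L γ ∧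
        ∀ s ∈ Metric.ball (0 : ℂ) 1, s ≠ 0 → ∃ Z : ℕ → Fin 4 → ℂ,
          incl (Z 0) = chartInv (cyclePt m c) (γ s) ∧
            IsAffineOrbit (rootPoly (parallelogram m a b)) Z ∧
              Tendsto (fun k => ‖Z k‖) atTop atTop := by
  set w := -2 * (a - b) ^ 2 / c ^ 2
  obtain ⟨w_ne_zero, h₁, h₂, prod_ne_zero, hlt⟩ := hw
  have w_mul : w * c ^ 2 = -2 * (a - b) ^ 2 := div_mul_cancel₀ _ (pow_ne_zero 2 H.ne_zero)
  obtain ⟨l, l', hsum, hprod, hl, hl'⟩ := exists_add_eq_mul_eq_norm_lt_one_lt_norm hlt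
  have hl₀ : l ≠ 0 := left_ne_zero_of_mul (hprod ▸ prod_ne_zero)
  have hne : l' - l ≠ 0 := _root_.sub_ne_zero.2 fun h => (hl.trans hl').ne (congrArg norm h.symm)
  obtain ⟨B, B_apply, hB⟩ := exists_diagonal_norm_symm_lt_one (μ := ![1 - w, 1 - 64 / w, l'])
    fun i => by fin_cases i <;> assumption
  refine (H.isTwistedFixedPoint m).exists_isLocalStableDisc (cyclePt_notMem_finitePart m c)
    (P := (eigenEquiv w H.ne_zero hne).toContinuousLinearEquiv) hl₀ hl hB (fun p => ?_) ?_
  · rw [H.fderiv_localMap_cyclePt w_mul, B_apply]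
    exact linPart_eigenEquiv H.ne_zero hne w_ne_zero hsum hprod p
  · intro a y i hi ha hy
    obtain rfl : i = 0 := by
      fin_cases i <;> simp [cyclePt] at hi ⊢
    exact eigenEquiv_apply_zero_ne_zero H.ne_zero hne ha hy

end IsGeometricMean

end Spectrum

end EA

end

theorem mainTheorem3 :
    ∃ U : Set ℂ, IsOpen U ∧ U.Nonempty ∧
      ∀ α : Fin 4 → ℂ, EA.IsParallelogram α →
        ∃ z z' : Fin 4 → EA.P1,
          EA.IsTwoCycle α z z' ∧ z ∉ EA.finitePart 4 ∧ z' ∉ EA.finitePart 4 ∧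
          (EA.CR (α 0) (α 1) (α 2) (α 3) ∈ U →
            ∃ L : (Fin 4 → ℂ) →L[ℂ] (Fin 4 → ℂ),
              HasFDerivAt (EA.localReturn α z) L (EA.chart z z) ∧
              EA.IsHyperbolicOneAttracting L ∧
              ∃ γ : ℂ → Fin 4 → ℂ,
                EA.IsLocalStableDisc α z L γ ∧
                ∀ s ∈ Metric.ball (0 : ℂ) 1, s ≠ 0 →
                  ∃ Z : ℕ → Fin 4 → ℂ,
                    EA.incl (Z 0) = EA.chartInv z (γ s) ∧
                    EA.IsAffineOrbit (EA.rootPoly α) Z ∧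
                    Tendsto (fun k => ‖Z k‖) atTop atTop) := by
  refine ⟨EA.saddleCrossRatios, EA.isOpen_saddleCrossRatios, ⟨2, EA.two_mem_saddleCrossRatios⟩,
    fun α hα => ?_⟩
  obtain ⟨m, a, b, c, rfl, H⟩ := hα.exists_eq_parallelogram
  refine ⟨EA.cyclePt m c, EA.cyclePt m c ∘ EA.swapPairs,
    (H.isTwistedFixedPoint m).isTwoCycle EA.swapPairs_ne_one,
    EA.cyclePt_notMem_finitePart m c, EA.cyclePt_comp_swapPairs_notMem_finitePart m c,
    fun hU => H.exists_isLocalStableDisc ?_ m⟩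
  exact H.eight_sub_eight_div_CR m ▸ hU.2
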